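/- **Setting.** Let $\Lambda$ be a finite connected graph with graph distance $d_{i,j}$, let $D\ge 1$ be an integer, and let $\gamma\ge 1$ be a lattice constant: $|\{j: d_{i,j}\le s\}|\le\gamma s^{D}$ and $|\{j:d_{i,j}=s\}|\le \gamma s^{D-1}$ for all $i\in\Lambda$ and all integers $s\ge1$. For $X\subseteq\Lambda$ put $X[r]=\{i: d_{i,X}\le r\}$, let $\partial X$ be the set of sites of $X$ with a neighbour outside $X$, and let $(\partial X)_s=\{i\in X: d_{i,\partial X}=|s|\}$ for integers $s\le 0$ and $(\partial X)_s=\{i\in X^{c}: d_{i,\partial X}=s\}$ for $s>0$. A spin $1/2$ sits at each site. The Hamiltonian is $H=\sum_{|Z|\le k}h_Z$, $h_Z=\sum_q J_{Z,q}P_{Z,q}$, where $P_{Z,q}$ ($1\le q\le 3^{|Z|}$) are the products of Pauli matrices $\sigma^x,\sigma^y,\sigma^z$ with support exactly $Z$ and $J_{Z,q}\in\mathbb R$. Let $\alpha>D$ and $J_0>0$ be such that $$\sum_{Z\supseteq\{i,i'\}}\|h_Z\|\le J_0(d_{i,i'}+1)^{-\alpha}\qquad\text{for all } i,i'\in\Lambda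 .$$ Let $g$ and $\lambda$ be any constants with $\sum_{(Z,q):Z\ni i}|J_{Z,q}|\le g$ for all $i$ and $\sum_{j\in\Lambda}(d_{i,j}+1)^{-\alpha}(d_{j,i'}+1)^{-\alpha}\le\lambda(d_{i,i'}+1)^{-\alpha}$ for all $i,i'$. Put $J=3^{k/2}J_0$, $\tilde g=\max(gk,\lambda J)$ and $$C_0=\frac{2^{\alpha-D/2+2}J_0\gamma}{2\alpha-D-1}+\frac{80\,\tilde g\,\gamma\,2^{\alpha-D/2}}{\alpha-D}\sqrt{2\alpha-2D+\gamma}.$$ Write $\|\cdot\|$ for the operator norm, $\|A\|_F=\sqrt{\mathrm{tr}(A^\dagger A)/\mathrm{tr}(1)}$, $W(t)=e^{iHt}We^{-iHt}$, and $W(t,\tilde X)=\frac{1}{\mathrm{tr}_{\tilde X^c}(1)}\mathrm{tr}_{\tilde X^c}[W(t)]\otimes 1_{\tilde X^c}$. **Theorem.** Let $X\subseteq\Lambda$, let $r\ge1$ be an integer, and assume that at least one of the following holds: (a) $\Lambda$ is a lattice region: it is a geodesically convex induced subgraph of a finite connected graph (possibly all of it) whose automorphism group is transitive on the vertices and for which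 $\gamma$ is also a lattice constant in dimension $D$ (for example a lattice with periodic boundary conditions, or a box in such a lattice); here $X$ is arbitrary; (b) $|(\partial X)_l|\le|(\partial X)_{\lfloor r/2\rfloor}|$ for all integers $l\le\lfloor r/2\rfloor$; here $\Lambda$ is arbitrary. Then for every operator $W_X$ acting on the spins in $X$ with $\|W_X\|=1$ and every real $t$ with $|t|\le 1/(2e\tilde g)$, $$\|W_X(t)-W_X(t,X[r])\|_F\le C_0|t|\sqrt{\gamma^{-1}\,|(\partial X)_{\lfloor r/2\rfloor}|\,r^{-2\alpha+D+1}} .$$ -/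

import Mathlib

noncomputable section

namespace LongRange

open scoped Classical in
/-- `i[s]`: the sites at graph distance at most `s` from the site `i`. -/
def ball {V : Type*} [Fintype V] (G : SimpleGraph V) (i : V) (s : ℕ) : Finset V :=
  Finset.univ.filter fun j => G.dist i j ≤ s

open scoped Classical in
/-- The sites at graph distance exactly `s` from the site `i`. -/
def sphere {V : Type*} [Fintype V] (G : SimpleGraph V) (i : V) (s : ℕ) : Finset V :=
  Finset.univ.filter fun j => G.dist i j = s

/-- `γ` is a lattice constant of the graph in dimension `D`: volumes of balls and sizes of
spheres of radius `s ≥ 1` are at most `γ s ^ D` and `γ s ^ (D - 1)`. -/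
def IsLatticeConstant {V : Type*} [Fintype V] (G : SimpleGraph V) (D : ℕ) (γ : ℝ) : Prop :=
  ∀ (i : V) (s : ℕ), 1 ≤ s →
    ((ball G i s).card : ℝ) ≤ γ * (s : ℝ) ^ (D : ℝ) ∧
    ((sphere G i s).card : ℝ) ≤ γ * (s : ℝ) ^ ((D : ℝ) - 1)

/-- All sites are equivalent under automorphisms of the graph. -/
def IsHomogeneous {V : Type*} (G : SimpleGraph V) : Prop :=
  ∀ i j : V, ∃ φ : G ≃g G, φ i = j

/-- `G` is a geodesically convex region of a finite connected homogeneous lattice with lattice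
constant `γ` in dimension `D`; `G` may be the entire lattice (periodic boundary conditions), or
for instance a rectangular box inside a sufficiently large torus (open boundary conditions). -/
def IsLatticeRegion {V : Type*} (G : SimpleGraph V) (D : ℕ) (γ : ℝ) : Prop :=
  ∃ (N : ℕ) (L : SimpleGraph (Fin N)) (f : G ↪g L),
    L.Connected ∧ IsHomogeneous L ∧ IsLatticeConstant L D γ ∧
    ∀ (i j : V) (v : Fin N),
      L.dist (f i) v + L.dist v (f j) = L.dist (f i) (f j) → v ∈ Set.range f

section Geometry

variable {V : Type*} [Fintype V] [DecidableEq V]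

/-- The distance `d_{i,Y}` of a site to a set of sites (infinite if `Y` is empty). -/
def distTo (G : SimpleGraph V) (i : V) (Y : Finset V) : ℕ∞ :=
  ⨅ j ∈ Y, G.edist i j

open scoped Classical in
/-- `X[r]`: the sites at distance at most `r` from `X`. -/
def nbhd (G : SimpleGraph V) (X : Finset V) (r : ℕ) : Finset V :=
  Finset.univ.filter fun i => distTo G i X ≤ (r : ℕ∞)

open scoped Classical in
/-- The surface `∂X`: the sites of `X` that have a neighbour outside `X`. -/
def surface (G : SimpleGraph V) (X : Finset V) : Finset V :=
  X.filter fun i => ∃ j, j ∉ X ∧ G.Adj i j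

open scoped Classical in
/-- The shell `(∂X)_s`: the sites at distance `|s|` from `∂X`, inside `X` if `s ≤ 0` and
outside `X` if `s > 0`. -/
def shell (G : SimpleGraph V) (X : Finset V) (s : ℤ) : Finset V :=
  if s ≤ 0 then X.filter fun i => distTo G i (surface G X) = (s.natAbs : ℕ∞)
  else Xᶜ.filter fun i => distTo G i (surface G X) = (s.natAbs : ℕ∞)

end Geometry

section Operators

variable {V : Type*} [Fintype V] [DecidableEq V]

/-- Operators on the Hilbert space of spins `1/2` sitting at the points of `V`, as matrices in
the computational basis. -/
abbrev Op (V : Type*) : Type _ := Matrix (V → Fin 2) (V → Fin 2) ℂ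

/-- The operator norm. -/
def opNorm (A : Op V) : ℝ := ‖Matrix.toEuclideanCLM (𝕜 := ℂ) A‖

/-- The normalized Frobenius norm `√(tr (A† A) / tr 1)`. -/
def frobNorm (A : Op V) : ℝ :=
  Real.sqrt ((Matrix.trace (A.conjTranspose * A)).re / (Matrix.trace (1 : Op V)).re)

/-- The operator `w ⊗ 1` for an operator `w` of the spins in `X`. -/
def extend (X : Finset V) (w : Op {i // i ∈ X}) : Op V := fun σ τ =>
  if ∀ i, i ∉ X → σ i = τ i then w (fun i => σ i) (fun i => τ i) else 0

/-- `A` acts on the spins in `X` only. -/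
def ActsOn (X : Finset V) (A : Op V) : Prop := ∃ w : Op {i // i ∈ X}, A = extend X w

/-- The configuration equal to `a` on `X` and to `b` outside `X`. -/
def glue (X : Finset V) (a : {i // i ∈ X} → Fin 2) (b : {i // i ∉ X} → Fin 2) : V → Fin 2 :=
  fun i => if h : i ∈ X then a ⟨i, h⟩ else b ⟨i, h⟩

/-- The partial trace over the spins outside `X`. -/
def partialTrace (X : Finset V) (A : Op V) : Op {i // i ∈ X} := fun a a' =>
  ∑ b : {i // i ∉ X} → Fin 2, A (glue X a b) (glue X a' b)

/-- The normalized partial trace over the spins outside `X`, tensored with the identity there. -/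
def localApprox (X : Finset V) (A : Op V) : Op V :=
  (Matrix.trace (1 : Op {i // i ∉ X}))⁻¹ • extend X (partialTrace X A)

/-- The Heisenberg evolution `exp(iHt) W exp(-iHt)`. -/
def evolve (H : Op V) (t : ℝ) (W : Op V) : Op V :=
  NormedSpace.exp ((Complex.I * (t : ℂ)) • H) * W * NormedSpace.exp ((-(Complex.I * (t : ℂ))) • H)

/-- The identity and the three Pauli matrices. -/
def pauli : Fin 4 → Matrix (Fin 2) (Fin 2) ℂ :=
  ![1, !![0, 1; 1, 0], !![0, -Complex.I; Complex.I, 0], !![1, 0; 0, -1]]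

/-- The product over all sites `i` of the Pauli matrix with label `p i` at `i`. -/
def pauliString (p : V → Fin 4) : Op V := fun σ τ => ∏ i, pauli (p i) (σ i) (τ i)

/-- The sites on which a Pauli string is not the identity. -/
def supp (p : V → Fin 4) : Finset V := Finset.univ.filter fun i => p i ≠ 0

/-- The interaction term `h_Z` with Pauli coefficients `c`: the sum of `c p` times the Pauli
string `p` over the `3 ^ |Z|` Pauli strings whose support is exactly `Z`. -/
def term (c : (V → Fin 4) → ℝ) (Z : Finset V) : Op V :=
  ∑ p ∈ Finset.univ.filter (fun p : V → Fin 4 => supp p = Z), (c p : ℂ) • pauliString p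

/-- The Hamiltonian `∑_Z h_Z`. -/
def hamiltonian (c : (V → Fin 4) → ℝ) : Op V := ∑ Z : Finset V, term c Z

/-- At most `k`-body interactions: `h_Z = 0` for `|Z| > k`. -/
def IsKLocal (c : (V → Fin 4) → ℝ) (k : ℕ) : Prop := ∀ p, k < (supp p).card → c p = 0

/-- Power-law decay: `∑_{Z ∋ i, i'} ‖h_Z‖ ≤ J₀ (d_{i,i'} + 1) ^ (-α)` for all `i, i'`
(`i = i'` included). -/
def PowerLawDecay (G : SimpleGraph V) (c : (V → Fin 4) → ℝ) (J₀ α : ℝ) : Prop :=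
  ∀ i i' : V,
    ∑ Z ∈ Finset.univ.filter (fun Z : Finset V => i ∈ Z ∧ i' ∈ Z), opNorm (term c Z)
      ≤ J₀ * ((G.dist i i' : ℝ) + 1) ^ (-α)

/-- `g` bounds the one-site energy: the sum of `|c p|` over the Pauli strings acting
nontrivially at a given site. -/
def OneSiteEnergyBound (c : (V → Fin 4) → ℝ) (g : ℝ) : Prop :=
  ∀ i : V, ∑ p ∈ Finset.univ.filter (fun p : V → Fin 4 => i ∈ supp p), |c p| ≤ g

/-- `lam` is a constant for the convolution of the power-law decay with itself. -/
def ConvolutionBound (G : SimpleGraph V) (α lam : ℝ) : Prop :=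
  ∀ i i' : V,
    ∑ j : V, ((G.dist i j : ℝ) + 1) ^ (-α) * ((G.dist j i' : ℝ) + 1) ^ (-α)
      ≤ lam * ((G.dist i i' : ℝ) + 1) ^ (-α)

end Operators

/-- `g̃ = max (g k, λ J)` with `J = 3 ^ (k / 2) J₀`. -/
def gTilde (g lam J₀ : ℝ) (k : ℕ) : ℝ :=
  max (g * k) (lam * ((3 : ℝ) ^ ((k : ℝ) / 2) * J₀))

/-- The constant `C₀`. -/
def constC (α J₀ γ gt : ℝ) (D : ℕ) : ℝ :=
  (2 : ℝ) ^ (α - (D : ℝ) / 2 + 2) * J₀ * γ / (2 * α - D - 1)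
    + 80 * gt * γ * (2 : ℝ) ^ (α - (D : ℝ) / 2) / (α - D) * Real.sqrt (2 * α - 2 * D + γ)

end LongRange

end

/-! Put h = ⌊r/2⌋, Y = X[h], R = X[r], and split H = A + B + T into the terms inside Y, those
outside Y and those crossing between the two. Under A + B alone, W evolves into an operator W₀ on Y.
In the interaction picture W(t) = U W₀ U†, where U has the generator T evolved by A + B. If u is a
unitary on R, then u W₀ u† acts on R, so the leakage of W(t) out of R is at most 2‖U - u‖_F. The
distance of U from the unitaries on R grows no faster than the leakage of the generator out of R
(`infDist_interactionPropagator_le`), and conjugation by A, acting inside R, does not affect that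
leakage.

It remains to bound the leakage of T evolved by B. Pauli strings are orthogonal, and every string of
T meets Y and continues to do so under B. Hence the squared leakage is at most the sum, over i in Y
and j outside R, of the squared norms of the components acting at both i and j. Since B does not
touch i, a Lieb–Robinson bound in Frobenius norm (`norm_part_evolve_le`) applies to the component at
i. It preserves the profile K(i,j) = (d+1)^(-α) up to a factor exp(2 J₀ λ |t|), because K reproduces
itself under convolution. Adding squares, where an operator-norm argument would add norms, produces
the exponent -2α + D + 1 under the root.

The remaining sum of K² is a count of pairs by distance s: at most (s - (r - h)) |(∂X)_h| γ s^(D-1)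
pairs. In case (b) the site in Y has only s - (r - h) possible levels, each no larger than level h.
In case (a) a mass-transport argument is used: every geodesic of such a pair crosses the shell at
level h at one of its first s - (r - h) times, and by homogeneity the geodesics spread evenly over
the sites at each time. A telescoping comparison sums over s. -/

noncomputable section

namespace LongRange

set_option linter.unusedSectionVars false

open Matrix

/-! ### Pauli strings as an orthogonal basis of the operators. -/

section PauliAlgebra

variable {V : Type*} [Fintype V] [DecidableEq V]

/-- The tensor product over all sites of one-site operators. -/
def tens (M : V → Matrix (Fin 2) (Fin 2) ℂ) : Op V := fun σ τ => ∏ i, M i (σ i) (τ i)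

lemma pauliString_eq_tens (p : V → Fin 4) : pauliString p = tens fun i => pauli (p i) := rfl

lemma tens_mul (M N : V → Matrix (Fin 2) (Fin 2) ℂ) :
    tens M * tens N = tens fun i => M i * N i := by
  ext σ τ
  simp only [Matrix.mul_apply, tens]
  rw [Finset.prod_univ_sum]
  simp [Finset.prod_mul_distrib]

lemma tens_conjTranspose (M : V → Matrix (Fin 2) (Fin 2) ℂ) :
    (tens M)ᴴ = tens fun i => (M i)ᴴ := by
  ext σ τ
  simp [tens, Matrix.conjTranspose_apply]

lemma tens_trace (M : V → Matrix (Fin 2) (Fin 2) ℂ) :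
    (tens M).trace = ∏ i, (M i).trace := by
  simp only [Matrix.trace, tens, Matrix.diag_apply]
  rw [Finset.prod_univ_sum]
  simp

lemma pauli_zero : pauli 0 = 1 := rfl

lemma pauli_trace_ne_zero {a : Fin 4} (ha : a ≠ 0) : (pauli a).trace = 0 := by
  fin_cases a <;> simp_all [pauli, Matrix.trace]

lemma pauli_conjTranspose (a : Fin 4) : (pauli a)ᴴ = pauli a := by
  fin_cases a <;> ext i j <;> fin_cases i <;> fin_cases j <;> simp [pauli]

lemma pauli_mul_trace (a b : Fin 4) :
    (pauli a * pauli b).trace = if a = b then 2 else 0 := by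
  fin_cases a <;> fin_cases b <;> simp [pauli, Matrix.trace] <;> norm_num

lemma pauli_completeness (a b a' b' : Fin 2) :
    ∑ q : Fin 4, pauli q a b * pauli q b' a' = if a = a' ∧ b = b' then 2 else 0 := by
  fin_cases a <;> fin_cases b <;> fin_cases a' <;> fin_cases b' <;>
    simp [Fin.sum_univ_four, pauli] <;> norm_num

lemma pauliString_conjTranspose (p : V → Fin 4) : (pauliString p)ᴴ = pauliString p := by
  simp [pauliString_eq_tens, tens_conjTranspose, pauli_conjTranspose]

lemma pauliString_mul_trace (p q : V → Fin 4) :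
    (pauliString p * pauliString q).trace = if p = q then (2 : ℂ) ^ Fintype.card V else 0 := by
  rw [pauliString_eq_tens, pauliString_eq_tens, tens_mul, tens_trace]
  simp only [pauli_mul_trace]
  split_ifs with h
  · subst h; simp
  · obtain ⟨i, hi⟩ := Function.ne_iff.mp h
    exact Finset.prod_eq_zero (Finset.mem_univ i) (by simp [hi])

/-- The coefficient of a Pauli string in the Pauli expansion of an operator. -/
def coeff (p : V → Fin 4) (A : Op V) : ℂ :=
  ((2 : ℂ) ^ Fintype.card V)⁻¹ * (pauliString p * A).trace

/-- Completeness factorises over the sites, so the one-site identity `pauli_completeness` suffices.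
It gives the expansion `sum_coeff_smul`. -/
lemma sum_pauliString_mul (σ τ σ' τ' : V → Fin 2) :
    ∑ p : V → Fin 4, pauliString p σ τ * pauliString p τ' σ' =
      if σ = σ' ∧ τ = τ' then (2 : ℂ) ^ Fintype.card V else 0 := by
  simp only [pauliString, ← Finset.prod_mul_distrib]
  have := Finset.prod_univ_sum (fun _ : V => (Finset.univ : Finset (Fin 4)))
    (fun i q => pauli q (σ i) (τ i) * pauli q (τ' i) (σ' i))
  simp only [Fintype.piFinset_univ] at this
  rw [← this]
  simp only [pauli_completeness]
  split_ifs with h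
  · obtain ⟨rfl, rfl⟩ := h; simp
  · by_cases h1 : σ = σ'
    · have h2 : τ ≠ τ' := fun h2 => h ⟨h1, h2⟩
      obtain ⟨i, hi⟩ := Function.ne_iff.mp h2
      exact Finset.prod_eq_zero (Finset.mem_univ i) (by simp [hi])
    · obtain ⟨i, hi⟩ := Function.ne_iff.mp h1
      exact Finset.prod_eq_zero (Finset.mem_univ i) (by simp [hi])

lemma sum_coeff_smul (A : Op V) : ∑ p, coeff p A • pauliString p = A := by
  ext σ τ
  simp only [Matrix.sum_apply, Matrix.smul_apply, smul_eq_mul, coeff, Matrix.trace,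
    Matrix.diag_apply, Matrix.mul_apply]
  calc ∑ p, ((2 : ℂ) ^ Fintype.card V)⁻¹ * (∑ a, ∑ b, pauliString p a b * A b a) * pauliString p σ τ
      = ((2 : ℂ) ^ Fintype.card V)⁻¹ * ∑ a, ∑ b, A b a *
          ∑ p, pauliString p σ τ * pauliString p a b := by
        simp only [Finset.mul_sum, Finset.sum_mul]
        rw [Finset.sum_comm]
        refine Finset.sum_congr rfl fun a _ => ?_
        rw [Finset.sum_comm]
        refine Finset.sum_congr rfl fun b _ => Finset.sum_congr rfl fun p _ => ?_
        ring
    _ = A σ τ := by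
        simp only [sum_pauliString_mul]
        rw [Finset.sum_eq_single τ, Finset.sum_eq_single σ]
        · simp; field_simp
        · intro b _ hb; simp [Ne.symm hb]
        · simp
        · intro a _ ha; simp [Ne.symm ha]
        · simp

lemma coeff_pauliString (p q : V → Fin 4) :
    coeff p (pauliString q) = if p = q then 1 else 0 := by
  simp only [coeff, pauliString_mul_trace]
  split_ifs <;> simp

lemma coeff_sub (p : V → Fin 4) (A B : Op V) : coeff p (A - B) = coeff p A - coeff p B := by
  simp [coeff, mul_sub]

lemma coeff_smul (p : V → Fin 4) (z : ℂ) (A : Op V) : coeff p (z • A) = z * coeff p A := by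
  simp [coeff]; ring

lemma coeff_sum {ι : Type*} (s : Finset ι) (p : V → Fin 4) (A : ι → Op V) :
    coeff p (∑ x ∈ s, A x) = ∑ x ∈ s, coeff p (A x) := by
  simp [coeff, Finset.mul_sum]

end PauliAlgebra

/-! ### The normalized partial trace as a conditional expectation. -/

section LocalApprox

variable {V : Type*} [Fintype V] [DecidableEq V]

lemma localApprox_apply (S : Finset V) (A : Op V) (σ τ : V → Fin 2) :
    localApprox S A σ τ = if ∀ i, i ∉ S → σ i = τ i then
      ((2 : ℂ) ^ Fintype.card {i // i ∉ S})⁻¹ *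
        ∑ b : {i // i ∉ S} → Fin 2, A (glue S (fun i => σ i) b) (glue S (fun i => τ i) b)
      else 0 := by
  simp only [localApprox, Matrix.smul_apply, extend, partialTrace, smul_eq_mul, mul_ite, mul_zero]
  simp [Matrix.trace_one]

lemma localApprox_add (S : Finset V) (A B : Op V) :
    localApprox S (A + B) = localApprox S A + localApprox S B := by
  ext σ τ
  simp only [localApprox_apply, Matrix.add_apply, Finset.sum_add_distrib]
  split_ifs <;> ring

lemma localApprox_smul (S : Finset V) (z : ℂ) (A : Op V) :
    localApprox S (z • A) = z • localApprox S A := by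
  ext σ τ
  simp only [localApprox_apply, Matrix.smul_apply, smul_eq_mul, ← Finset.mul_sum]
  split_ifs <;> ring

/-- `localApprox` as a linear map. -/
def localApproxₗ (S : Finset V) : Op V →ₗ[ℂ] Op V where
  toFun := localApprox S
  map_add' := localApprox_add S
  map_smul' := localApprox_smul S

lemma localApproxₗ_apply (S : Finset V) (A : Op V) : localApproxₗ S A = localApprox S A := rfl

lemma localApprox_sum {ι : Type*} (s : Finset ι) (S : Finset V) (A : ι → Op V) :
    localApprox S (∑ x ∈ s, A x) = ∑ x ∈ s, localApprox S (A x) :=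
  map_sum (localApproxₗ S) A s

lemma localApprox_sub (S : Finset V) (A B : Op V) :
    localApprox S (A - B) = localApprox S A - localApprox S B :=
  map_sub (localApproxₗ S) A B

/-- The normalized trace acts factor by factor. As nontrivial Pauli matrices are traceless, a string
is either kept or annihilated. -/
lemma localApprox_tens (S : Finset V) (M : V → Matrix (Fin 2) (Fin 2) ℂ) :
    localApprox S (tens M) =
      tens fun i => if i ∈ S then M i else ((M i).trace / 2) • (1 : Matrix (Fin 2) (Fin 2) ℂ) := by
  ext σ τ
  rw [localApprox_apply]
  have hsplit : ∀ f : V → ℂ, ∏ i, f i =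
      (∏ i : {i // i ∈ S}, f i) * ∏ i : {i // i ∉ S}, f i := fun f => by
    convert (Fintype.prod_subtype_mul_prod_subtype (fun i => i ∈ S) f).symm
  simp only [tens]
  rw [hsplit]
  have h1 : ∀ i : {i // i ∉ S}, (if (i : V) ∈ S then M i else
      ((M i).trace / 2) • (1 : Matrix (Fin 2) (Fin 2) ℂ)) (σ i) (τ i) =
      if σ i = τ i then (M i).trace / 2 else 0 := fun i => by
    simp [i.2, Matrix.one_apply]
  have h2 : ∀ i : {i // i ∈ S}, (if (i : V) ∈ S then M i else
      ((M i).trace / 2) • (1 : Matrix (Fin 2) (Fin 2) ℂ)) (σ i) (τ i) = M i (σ i) (τ i) :=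
    fun i => by simp [i.2]
  simp only [h1, h2]
  split_ifs with h
  · have h3 : ∀ b : {i // i ∉ S} → Fin 2,
        ∏ i, M i (glue S (fun i => σ i) b i) (glue S (fun i => τ i) b i) =
        (∏ i : {i // i ∈ S}, M i (σ i) (τ i)) * ∏ i : {i // i ∉ S}, M i (b i) (b i) := fun b => by
      rw [hsplit]
      congr 1
      · exact Finset.prod_congr rfl fun i _ => by simp [glue, i.2]
      · exact Finset.prod_congr rfl fun i _ => by simp [glue, i.2]
    simp only [h3, ← Finset.mul_sum]
    have h4 : ∑ b : {i // i ∉ S} → Fin 2, ∏ i : {i // i ∉ S}, M i (b i) (b i) =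
        ∏ i : {i // i ∉ S}, (M i).trace := by
      simp only [Matrix.trace, Matrix.diag_apply]
      rw [Finset.prod_univ_sum]
      simp
    rw [h4]
    have h5 : ∀ i : {i // i ∉ S}, (if σ i = τ i then (M i).trace / 2 else 0) =
        (M i).trace * (2 : ℂ)⁻¹ := fun i => by simp [h i i.2, div_eq_mul_inv]
    simp only [h5, Finset.prod_mul_distrib, Finset.prod_const, Finset.card_univ]
    rw [inv_pow]; ring
  · push Not at h
    obtain ⟨i, hi, hne⟩ := h
    have : ∏ i : {i // i ∉ S}, (if σ i = τ i then (M i).trace / 2 else 0) = 0 :=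
      Finset.prod_eq_zero (Finset.mem_univ ⟨i, hi⟩) (by simp [hne])
    rw [this, mul_zero]

lemma mem_supp {p : V → Fin 4} {i : V} : i ∈ supp p ↔ p i ≠ 0 := by simp [supp]

lemma localApprox_pauliString (S : Finset V) (p : V → Fin 4) :
    localApprox S (pauliString p) = if supp p ⊆ S then pauliString p else 0 := by
  rw [pauliString_eq_tens, localApprox_tens]
  split_ifs with h
  · congr 1
    ext1 i
    split_ifs with hi
    · rfl
    · have : p i = 0 := by
        by_contra h0
        exact hi (h (mem_supp.2 h0))
      simp [this, pauli_zero]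
  · obtain ⟨i, hi, hS⟩ := Finset.not_subset.mp h
    ext σ τ
    exact Finset.prod_eq_zero (Finset.mem_univ i)
      (by simp [hS, pauli_trace_ne_zero (mem_supp.1 hi)])

/-- The partial trace only masks Pauli coefficients. Later identities between such projections are
thereby reduced to case distinctions on supports. -/
lemma coeff_localApprox (S : Finset V) (p : V → Fin 4) (A : Op V) :
    coeff p (localApprox S A) = if supp p ⊆ S then coeff p A else 0 := by
  conv_lhs => rw [← sum_coeff_smul A, localApprox_sum]
  simp only [localApprox_smul, localApprox_pauliString, coeff_sum, coeff_smul]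
  rw [Finset.sum_eq_single p]
  · split_ifs <;> simp [coeff_pauliString]
    simp [coeff]
  · intro q _ hq
    split_ifs
    · simp [coeff_pauliString, Ne.symm hq]
    · simp [coeff]
  · simp

lemma eq_of_coeff_eq {A B : Op V} (h : ∀ p, coeff p A = coeff p B) : A = B := by
  rw [← sum_coeff_smul A, ← sum_coeff_smul B]
  simp [h]

lemma actsOn_localApprox (S : Finset V) (A : Op V) : ActsOn S (localApprox S A) := by
  refine ⟨(Matrix.trace (1 : Op {i // i ∉ S}))⁻¹ • partialTrace S A, ?_⟩
  ext σ τ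
  simp [localApprox, extend]

lemma ActsOn.localApprox_eq {S : Finset V} {A : Op V} (hA : ActsOn S A) :
    localApprox S A = A := by
  obtain ⟨w, rfl⟩ := hA
  ext σ τ
  rw [localApprox_apply]
  conv_rhs => rw [extend]
  split_ifs with h
  · have : ∀ b : {i // i ∉ S} → Fin 2,
        extend S w (glue S (fun i => σ i) b) (glue S (fun i => τ i) b) =
          w (fun i => σ i) (fun i => τ i) := fun b => by
      rw [extend, if_pos]
      · congr 1 <;> ext i <;> simp [glue]
      · intro i hi
        simp [glue, hi]
    simp only [this, Finset.sum_const, Finset.card_univ]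
    simp
  · rfl

lemma actsOn_iff_localApprox_eq {S : Finset V} {A : Op V} :
    ActsOn S A ↔ localApprox S A = A :=
  ⟨fun h => h.localApprox_eq, fun h => h ▸ actsOn_localApprox S A⟩

lemma actsOn_iff_coeff {S : Finset V} {A : Op V} :
    ActsOn S A ↔ ∀ p, ¬ supp p ⊆ S → coeff p A = 0 := by
  rw [actsOn_iff_localApprox_eq]
  constructor
  · intro h p hp
    rw [← h, coeff_localApprox, if_neg hp]
  · intro h
    refine eq_of_coeff_eq fun p => ?_
    rw [coeff_localApprox]
    split_ifs with hp
    · rfl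
    · exact (h p hp).symm

lemma ActsOn.mono {S T : Finset V} {A : Op V} (hA : ActsOn S A) (h : S ⊆ T) : ActsOn T A :=
  actsOn_iff_coeff.2 fun p hp => actsOn_iff_coeff.1 hA p fun hs => hp (hs.trans h)

lemma ActsOn.smul {S : Finset V} {A : Op V} (z : ℂ) (hA : ActsOn S A) : ActsOn S (z • A) := by
  rw [actsOn_iff_localApprox_eq] at *
  rw [localApprox_smul, hA]

lemma ActsOn.sum {ι : Type*} {s : Finset ι} {S : Finset V} {A : ι → Op V}
    (hA : ∀ x ∈ s, ActsOn S (A x)) : ActsOn S (∑ x ∈ s, A x) := by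
  rw [actsOn_iff_localApprox_eq, localApprox_sum]
  exact Finset.sum_congr rfl fun x hx => (hA x hx).localApprox_eq

lemma actsOn_pauliString {S : Finset V} {p : V → Fin 4} (h : supp p ⊆ S) :
    ActsOn S (pauliString p) := by
  rw [actsOn_iff_localApprox_eq, localApprox_pauliString, if_pos h]

lemma actsOn_one (S : Finset V) : ActsOn S (1 : Op V) := by
  have : (1 : Op V) = pauliString 0 := by
    ext σ τ
    simp only [pauliString, Pi.zero_apply, pauli_zero, Matrix.one_apply, Finset.prod_ite_zero]
    simp [funext_iff]
  rw [this]
  exact actsOn_pauliString (by intro i; simp [mem_supp])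

/-- The Pauli expansion of an operator acting on `S`. -/
lemma ActsOn.eq_sum {S : Finset V} {A : Op V} (hA : ActsOn S A) :
    A = ∑ p ∈ Finset.univ.filter (fun p => supp p ⊆ S), coeff p A • pauliString p := by
  conv_lhs => rw [← sum_coeff_smul A]
  rw [Finset.sum_filter]
  refine Finset.sum_congr rfl fun p _ => ?_
  split_ifs with h
  · rfl
  · rw [actsOn_iff_coeff.1 hA p h, zero_smul]

lemma localApprox_pauliString_mul {S : Finset V} {q : V → Fin 4} (hq : supp q ⊆ S)
    (p : V → Fin 4) : localApprox S (pauliString q * pauliString p) =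
      pauliString q * localApprox S (pauliString p) := by
  simp only [pauliString_eq_tens, tens_mul, localApprox_tens]
  congr 1
  ext1 i
  split_ifs with hi
  · rfl
  · have : q i = 0 := by
      by_contra h0
      exact hi (hq (mem_supp.2 h0))
    simp [this, pauli_zero]

lemma localApprox_mul_pauliString {S : Finset V} {q : V → Fin 4} (hq : supp q ⊆ S)
    (p : V → Fin 4) : localApprox S (pauliString p * pauliString q) =
      localApprox S (pauliString p) * pauliString q := by
  simp only [pauliString_eq_tens, tens_mul, localApprox_tens]
  congr 1
  ext1 i
  split_ifs with hi
  · rfl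
  · have : q i = 0 := by
      by_contra h0
      exact hi (hq (mem_supp.2 h0))
    simp [this, pauli_zero]

/-- The module property of a conditional expectation, checked on strings: a string supported in S is
the identity at every site that is traced out. -/
lemma ActsOn.localApprox_mul_left {S : Finset V} {B : Op V} (hB : ActsOn S B) (A : Op V) :
    localApprox S (B * A) = B * localApprox S A := by
  rw [hB.eq_sum]
  conv_lhs => rw [← sum_coeff_smul A]
  conv_rhs => rw [← sum_coeff_smul A]
  simp only [Finset.sum_mul, Finset.mul_sum, localApprox_sum, localApprox_smul,
    Matrix.smul_mul, Matrix.mul_smul]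
  refine Finset.sum_congr rfl fun p _ => Finset.sum_congr rfl fun q hq => ?_
  rw [localApprox_pauliString_mul (by simpa using hq)]

lemma ActsOn.localApprox_mul_right {S : Finset V} {B : Op V} (hB : ActsOn S B) (A : Op V) :
    localApprox S (A * B) = localApprox S A * B := by
  rw [hB.eq_sum]
  conv_lhs => rw [← sum_coeff_smul A]
  conv_rhs => rw [← sum_coeff_smul A]
  simp only [Finset.sum_mul, Finset.mul_sum, localApprox_sum, localApprox_smul,
    Matrix.smul_mul, Matrix.mul_smul]
  refine Finset.sum_congr rfl fun q hq => Finset.sum_congr rfl fun p _ => ?_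
  rw [localApprox_mul_pauliString (by simpa using hq)]

lemma ActsOn.mul {S : Finset V} {A B : Op V} (hA : ActsOn S A) (hB : ActsOn S B) :
    ActsOn S (A * B) := by
  rw [actsOn_iff_localApprox_eq, hA.localApprox_mul_left, hB.localApprox_eq]

lemma pauliString_commute {p q : V → Fin 4} (h : Disjoint (supp p) (supp q)) :
    Commute (pauliString p) (pauliString q) := by
  rw [commute_iff_eq]
  simp only [pauliString_eq_tens, tens_mul]
  congr 1
  ext1 i
  by_cases hp : p i = 0
  · simp [hp, pauli_zero]
  · have : q i = 0 := by
      by_contra hq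
      exact Finset.disjoint_left.1 h (mem_supp.2 hp) (mem_supp.2 hq)
    simp [this, pauli_zero]

lemma ActsOn.commute {S T : Finset V} {A B : Op V} (hA : ActsOn S A) (hB : ActsOn T B)
    (h : Disjoint S T) : Commute A B := by
  rw [hA.eq_sum, hB.eq_sum]
  refine Commute.sum_left _ _ _ fun p hp => Commute.sum_right _ _ _ fun q hq => ?_
  refine ((pauliString_commute ?_).smul_left _).smul_right _
  simp only [Finset.mem_filter, Finset.mem_univ, true_and] at hp hq
  exact Disjoint.mono hp hq h

lemma ActsOn.pow {S : Finset V} {A : Op V} (hA : ActsOn S A) (n : ℕ) : ActsOn S (A ^ n) := by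
  induction n with
  | zero => simpa using actsOn_one S
  | succ n ih => rw [pow_succ]; exact ih.mul hA

-- The operators on S are the fixed points of a continuous linear map, so the limit of the
-- exponential series stays among them.
open scoped Matrix.Norms.Frobenius in
lemma ActsOn.exp {S : Finset V} {A : Op V} (hA : ActsOn S A) : ActsOn S (NormedSpace.exp A) := by
  rw [actsOn_iff_localApprox_eq]
  have hs := NormedSpace.exp_series_hasSum_exp' (𝕂 := ℂ) A
  have hc : Continuous (localApproxₗ (V := V) S) := LinearMap.continuous_of_finiteDimensional _
  have hs' := hs.map (localApproxₗ S) hc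
  have : (localApproxₗ S ∘ fun n : ℕ => ((n.factorial : ℂ)⁻¹) • A ^ n) =
      fun n : ℕ => ((n.factorial : ℂ)⁻¹) • A ^ n := by
    ext1 n
    exact ((hA.pow n).smul _).localApprox_eq
  rw [this] at hs'
  exact hs'.unique hs

lemma actsOn_term (c : (V → Fin 4) → ℝ) (Z : Finset V) : ActsOn Z (term c Z) := by
  refine ActsOn.sum fun p hp => (actsOn_pauliString ?_).smul _
  simp only [Finset.mem_filter, Finset.mem_univ, true_and] at hp
  exact hp.subset

lemma term_conjTranspose (c : (V → Fin 4) → ℝ) (Z : Finset V) : (term c Z)ᴴ = term c Z := by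
  simp [term, Matrix.conjTranspose_sum, pauliString_conjTranspose]

lemma localApprox_conjTranspose (S : Finset V) (A : Op V) :
    localApprox S Aᴴ = (localApprox S A)ᴴ := by
  ext σ τ
  simp only [localApprox_apply, Matrix.conjTranspose_apply]
  simp only [eq_comm (a := τ _)]
  split_ifs <;> simp

end LocalApprox

/-! ### Frobenius geometry of Pauli expansions. -/

section Norms

open scoped Matrix.Norms.Frobenius

variable {V : Type*} [Fintype V] [DecidableEq V]

lemma frobenius_sq (A : Op V) : ‖A‖ ^ 2 = ∑ i, ∑ j, ‖A i j‖ ^ 2 := by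
  rw [Matrix.frobenius_norm_def, ← Real.sqrt_eq_rpow, Real.sq_sqrt]
  · simp
  · positivity

lemma trace_conjTranspose_mul_self (A : Op V) : (Aᴴ * A).trace = ((‖A‖ ^ 2 : ℝ) : ℂ) := by
  rw [frobenius_sq, Finset.sum_comm]
  simp only [Matrix.trace, Matrix.diag_apply, Matrix.mul_apply, Matrix.conjTranspose_apply]
  push_cast
  refine Finset.sum_congr rfl fun i _ => Finset.sum_congr rfl fun j _ => ?_
  exact Complex.conj_mul' _

lemma frobNorm_eq (A : Op V) : frobNorm A = ‖A‖ / √(2 ^ Fintype.card V) := by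
  rw [frobNorm, trace_conjTranspose_mul_self, Matrix.trace_one, Complex.ofReal_re, Real.sqrt_div,
    Real.sqrt_sq (norm_nonneg _)]
  · congr 2
    rw [Complex.natCast_re]
    simp
  · positivity

/-- Parseval; the power of 2 appears because the Frobenius norm used in the proof is not normalized.
-/
lemma sum_norm_coeff_sq (A : Op V) :
    ‖A‖ ^ 2 = 2 ^ Fintype.card V * ∑ p, ‖coeff p A‖ ^ 2 := by
  have h : (((‖A‖ ^ 2 : ℝ)) : ℂ) = ((2 ^ Fintype.card V * ∑ p, ‖coeff p A‖ ^ 2 : ℝ) : ℂ) := by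
    rw [← trace_conjTranspose_mul_self]
    conv_lhs => enter [1, 1]; rw [← sum_coeff_smul A]
    simp only [Matrix.conjTranspose_sum, Matrix.conjTranspose_smul, pauliString_conjTranspose,
      Finset.sum_mul, Matrix.trace_sum, Matrix.smul_mul, Matrix.trace_smul, smul_eq_mul]
    push_cast
    rw [Finset.mul_sum]
    refine Finset.sum_congr rfl fun p _ => ?_
    rw [← Complex.conj_mul']
    simp only [coeff]
    have h2 : (starRingEnd ℂ) (2 : ℂ) = 2 := Complex.conj_ofNat 2
    simp only [RCLike.star_def, map_mul, map_inv₀, map_pow, h2]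
    field_simp
  exact_mod_cast h

lemma norm_le_of_coeff_le {A B : Op V} (h : ∀ p, ‖coeff p A‖ ≤ ‖coeff p B‖) : ‖A‖ ≤ ‖B‖ := by
  refine le_of_sq_le_sq ?_ (norm_nonneg _)
  rw [sum_norm_coeff_sq, sum_norm_coeff_sq]
  gcongr with p
  exact h p

/-- An orthogonal projection gives the best approximation, so any operator on S may serve as a
competitor. -/
lemma norm_sub_localApprox_le {S : Finset V} {A B : Op V} (hB : ActsOn S B) :
    ‖A - localApprox S A‖ ≤ ‖A - B‖ := by
  refine norm_le_of_coeff_le fun p => ?_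
  rw [coeff_sub, coeff_localApprox, coeff_sub]
  split_ifs with h
  · simp
  · rw [actsOn_iff_coeff.1 hB p h]

lemma norm_sub_localApprox_le_self (S : Finset V) (A : Op V) :
    ‖A - localApprox S A‖ ≤ ‖A‖ := by
  simpa using norm_sub_localApprox_le (A := A) (B := (0 : ℂ) • (1 : Op V))
    ((actsOn_one S).smul 0)

lemma subset_compl_singleton {j : V} {S : Finset V} : S ⊆ {j}ᶜ ↔ j ∉ S := by
  rw [Finset.subset_compl_comm, Finset.singleton_subset_iff, Finset.mem_compl]

/-- The part of an operator made of the Pauli strings acting nontrivially at the site `j`. -/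
def part (j : V) (A : Op V) : Op V := A - localApprox {j}ᶜ A

lemma coeff_part (j : V) (p : V → Fin 4) (A : Op V) :
    coeff p (part j A) = if j ∈ supp p then coeff p A else 0 := by
  rw [part, coeff_sub, coeff_localApprox]
  have : supp p ⊆ {j}ᶜ ↔ j ∉ supp p := by
    rw [subset_compl_singleton]
  simp only [this]
  by_cases h : j ∈ supp p <;> simp [h]

lemma norm_part_le (j : V) (A : Op V) : ‖part j A‖ ≤ ‖A‖ := norm_sub_localApprox_le_self _ _

lemma part_part_comm (i j : V) (A : Op V) : part i (part j A) = part j (part i A) := by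
  refine eq_of_coeff_eq fun p => ?_
  simp only [coeff_part]
  split_ifs <;> rfl

lemma part_eq_zero {j : V} {S : Finset V} {A : Op V} (hA : ActsOn S A) (h : j ∉ S) :
    part j A = 0 := by
  rw [part, (hA.mono (subset_compl_singleton.2 h)).localApprox_eq, sub_self]

/-- `part` as a linear map. -/
def partₗ (j : V) : Op V →ₗ[ℂ] Op V := LinearMap.id - localApproxₗ {j}ᶜ

lemma partₗ_apply (j : V) (A : Op V) : partₗ j A = part j A := rfl

lemma part_sum {ι : Type*} (s : Finset ι) (j : V) (A : ι → Op V) :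
    part j (∑ x ∈ s, A x) = ∑ x ∈ s, part j (A x) := map_sum (partₗ j) A s

lemma ActsOn.part_mul_left {j : V} {S : Finset V} {B : Op V} (hB : ActsOn S B) (h : j ∉ S)
    (A : Op V) : part j (B * A) = B * part j A := by
  rw [part, (hB.mono (subset_compl_singleton.2 h)).localApprox_mul_left, part, mul_sub]

lemma ActsOn.part_mul_right {j : V} {S : Finset V} {B : Op V} (hB : ActsOn S B) (h : j ∉ S)
    (A : Op V) : part j (A * B) = part j A * B := by
  rw [part, (hB.mono (subset_compl_singleton.2 h)).localApprox_mul_right, part, sub_mul]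

/-- A string leaking out of S is counted on the right once for each site of its support outside S,
hence at least once. -/
lemma norm_sub_localApprox_sq_le (S : Finset V) (A : Op V) :
    ‖A - localApprox S A‖ ^ 2 ≤ ∑ j ∈ Sᶜ, ‖part j A‖ ^ 2 := by
  simp only [sum_norm_coeff_sq, ← Finset.mul_sum]
  gcongr
  rw [Finset.sum_comm]
  refine Finset.sum_le_sum fun p _ => ?_
  simp only [coeff_part, coeff_sub, coeff_localApprox]
  split_ifs with h
  · simp; positivity
  · obtain ⟨j, hj, hS⟩ := Finset.not_subset.1 h
    refine le_trans ?_ (Finset.single_le_sum (fun _ _ => by positivity)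
      (Finset.mem_compl.2 hS))
    simp [hj]

/-- If all Pauli strings of `A` act nontrivially somewhere in `Y`, then `A` is bounded by its
parts at the sites of `Y`. -/
lemma norm_sq_le_sum_part {Y : Finset V} {A : Op V}
    (h : localApprox Yᶜ A = 0) : ‖A‖ ^ 2 ≤ ∑ j ∈ Y, ‖part j A‖ ^ 2 := by
  have := norm_sub_localApprox_sq_le Yᶜ A
  rwa [h, sub_zero, compl_compl] at this

lemma norm_sub_localApprox_compl_le_sum (Z : Finset V) (A : Op V) :
    ‖A - localApprox Zᶜ A‖ ≤ ∑ j ∈ Z, ‖part j A‖ := by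
  refine le_of_sq_le_sq ((norm_sub_localApprox_sq_le Zᶜ A).trans ?_) (by positivity)
  rw [compl_compl]
  exact Finset.sum_sq_le_sq_sum_of_nonneg fun _ _ => norm_nonneg _

lemma norm_sq_eq_sum_col (A : Op V) :
    ‖A‖ ^ 2 = ∑ j, ‖(WithLp.toLp 2 (fun i => A i j) : EuclideanSpace ℂ (V → Fin 2))‖ ^ 2 := by
  rw [frobenius_sq, Finset.sum_comm]
  simp [EuclideanSpace.norm_sq_eq]

/-- The squared Frobenius norm is the sum of the squared lengths of the columns, and A acts on each
column separately. -/
lemma norm_mul_le_opNorm_mul (A B : Op V) : ‖A * B‖ ≤ opNorm A * ‖B‖ := by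
  have h0 : 0 ≤ opNorm A := norm_nonneg _
  refine le_of_sq_le_sq ?_ (by positivity)
  rw [mul_pow, norm_sq_eq_sum_col, norm_sq_eq_sum_col, Finset.mul_sum]
  refine Finset.sum_le_sum fun j _ => ?_
  rw [← mul_pow]
  gcongr
  have := (Matrix.toEuclideanCLM (𝕜 := ℂ) A).le_opNorm (WithLp.toLp 2 (fun i => B i j))
  rw [Matrix.toEuclideanCLM_toLp] at this
  exact this

lemma opNorm_conjTranspose (A : Op V) : opNorm Aᴴ = opNorm A := by
  rw [opNorm, opNorm, ← Matrix.star_eq_conjTranspose, map_star]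
  exact norm_star (Matrix.toEuclideanCLM (𝕜 := ℂ) A)

lemma norm_mul_le_mul_opNorm (A B : Op V) : ‖A * B‖ ≤ ‖A‖ * opNorm B := by
  rw [← Matrix.frobenius_norm_conjTranspose (A * B), Matrix.conjTranspose_mul, mul_comm,
    ← opNorm_conjTranspose, ← Matrix.frobenius_norm_conjTranspose A]
  exact norm_mul_le_opNorm_mul _ _

lemma opNorm_mul_le (A B : Op V) : opNorm (A * B) ≤ opNorm A * opNorm B := by
  simp only [opNorm, map_mul]
  exact norm_mul_le _ _

lemma opNorm_le_one_of_unitary {U : Op V} (h : Uᴴ * U = 1) : opNorm U ≤ 1 := by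
  have h1 : ‖Matrix.toEuclideanCLM (𝕜 := ℂ) U‖ * ‖Matrix.toEuclideanCLM (𝕜 := ℂ) U‖ = 1 := by
    rw [← CStarRing.norm_star_mul_self, ← map_star, ← map_mul, Matrix.star_eq_conjTranspose, h,
      map_one, norm_one]
  exact abs_le_one_iff_mul_self_le_one.2 h1.le |>.trans' (le_abs_self _)

lemma norm_unitary_mul {U : Op V} (h : Uᴴ * U = 1) (A : Op V) : ‖U * A‖ = ‖A‖ := by
  have h1 : ((‖U * A‖ ^ 2 : ℝ) : ℂ) = ((‖A‖ ^ 2 : ℝ) : ℂ) := by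
    rw [← trace_conjTranspose_mul_self, ← trace_conjTranspose_mul_self, Matrix.conjTranspose_mul,
      Matrix.mul_assoc, ← Matrix.mul_assoc Uᴴ, h, Matrix.one_mul]
  exact (sq_eq_sq₀ (norm_nonneg _) (norm_nonneg _)).1 (by exact_mod_cast h1)

lemma norm_mul_unitary {U : Op V} (h : U * Uᴴ = 1) (A : Op V) : ‖A * U‖ = ‖A‖ := by
  rw [← Matrix.frobenius_norm_conjTranspose (A * U), Matrix.conjTranspose_mul,
    norm_unitary_mul (by simpa using h), Matrix.frobenius_norm_conjTranspose]

lemma norm_one_eq : ‖(1 : Op V)‖ = √(2 ^ Fintype.card V) := by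
  rw [← Real.sqrt_sq (norm_nonneg (1 : Op V))]
  congr 1
  have := trace_conjTranspose_mul_self (1 : Op V)
  simp only [Matrix.conjTranspose_one, mul_one, Matrix.trace_one] at this
  have h2 : ((Fintype.card (V → Fin 2) : ℝ)) = ‖(1 : Op V)‖ ^ 2 := by exact_mod_cast this
  rw [← h2]
  simp

lemma norm_le_opNorm (A : Op V) : ‖A‖ ≤ opNorm A * √(2 ^ Fintype.card V) := by
  have := norm_mul_le_opNorm_mul A 1
  rwa [mul_one, norm_one_eq] at this

/-- Only the part of `A` overlapping with `Z` contributes to the commutator with an operator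
on `Z`. -/
lemma norm_commutator_le {Z : Finset V} {B : Op V} (hB : ActsOn Z B) (A : Op V) :
    ‖B * A - A * B‖ ≤ 2 * opNorm B * ∑ j ∈ Z, ‖part j A‖ := by
  have hc : B * localApprox Zᶜ A = localApprox Zᶜ A * B :=
    hB.commute (actsOn_localApprox Zᶜ A) disjoint_compl_right
  have h : B * A - A * B = B * (A - localApprox Zᶜ A) - (A - localApprox Zᶜ A) * B := by
    rw [mul_sub, sub_mul, hc]; abel
  rw [h]
  refine (norm_sub_le _ _).trans ?_
  have h1 := norm_mul_le_opNorm_mul B (A - localApprox Zᶜ A)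
  have h2 := norm_mul_le_mul_opNorm (A - localApprox Zᶜ A) B
  have h3 := norm_sub_localApprox_compl_le_sum Z A
  have h0 : 0 ≤ opNorm B := norm_nonneg _
  nlinarith [mul_le_mul_of_nonneg_left h3 h0]

end Norms

/-! ### Unitary propagators and their derivatives. -/

section Propagator

open scoped Matrix.Norms.Frobenius

variable {V : Type*} [Fintype V] [DecidableEq V]

/-- The propagator `exp(iHt)`. -/
def propagator (H : Op V) (t : ℝ) : Op V := NormedSpace.exp ((Complex.I * (t : ℂ)) • H)

lemma evolve_eq (H : Op V) (t : ℝ) (W : Op V) :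
    evolve H t W = propagator H t * W * propagator H (-t) := by
  simp [evolve, propagator]

lemma propagator_zero (H : Op V) : propagator H 0 = 1 := by
  simp [propagator]

lemma propagator_mul_neg (H : Op V) (t : ℝ) : propagator H t * propagator H (-t) = 1 := by
  rw [propagator, propagator, ← Matrix.exp_add_of_commute]
  · rw [← add_smul]; simp
  · exact ((Commute.refl H).smul_left _).smul_right _

lemma propagator_neg_mul (H : Op V) (t : ℝ) : propagator H (-t) * propagator H t = 1 := by
  simpa using propagator_mul_neg H (-t)

lemma propagator_add (A B : Op V) (h : Commute A B) (t : ℝ) :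
    propagator (A + B) t = propagator A t * propagator B t := by
  rw [propagator, smul_add, Matrix.exp_add_of_commute]
  · rfl
  · exact (h.smul_left _).smul_right _

lemma propagator_conjTranspose {H : Op V} (hH : Hᴴ = H) (t : ℝ) :
    (propagator H t)ᴴ = propagator H (-t) := by
  rw [propagator, ← Matrix.exp_conjTranspose, Matrix.conjTranspose_smul, hH, propagator]
  simp

lemma ActsOn.propagator {S : Finset V} {H : Op V} (hH : ActsOn S H) (t : ℝ) :
    ActsOn S (propagator H t) := (hH.smul _).exp

lemma commute_propagator {H A : Op V} (h : Commute H A) (t : ℝ) :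
    Commute (propagator H t) A := (h.smul_left _).exp_left

lemma hasDerivAt_propagator (H : Op V) (t : ℝ) :
    HasDerivAt (propagator H) ((Complex.I • H) * propagator H t) t := by
  have h : HasDerivAt (fun t : ℝ => NormedSpace.exp (t • (Complex.I • H)))
      ((Complex.I • H) * NormedSpace.exp (t • (Complex.I • H))) t :=
    hasDerivAt_exp_smul_const' (𝕂 := ℝ) (Complex.I • H) t
  have e : ∀ t : ℝ, NormedSpace.exp (t • (Complex.I • H)) = LongRange.propagator H t := fun t => by
    rw [LongRange.propagator, mul_comm, mul_smul]; rfl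
  simp only [e] at h
  exact h

lemma hasDerivAt_propagator' (H : Op V) (t : ℝ) :
    HasDerivAt (propagator H) (propagator H t * (Complex.I • H)) t := by
  have := hasDerivAt_propagator H t
  rwa [← (commute_propagator ((Commute.refl H).smul_right Complex.I) t).eq] at this

lemma hasDerivAt_propagator_neg (H : Op V) (t : ℝ) :
    HasDerivAt (fun t => propagator H (-t)) (-((Complex.I • H) * propagator H (-t))) t := by
  have := (hasDerivAt_propagator H (-t)).scomp t (hasDerivAt_neg t)
  simp only [neg_smul, one_smul] at this
  exact this

lemma hasDerivAt_propagator_neg' (H : Op V) (t : ℝ) :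
    HasDerivAt (fun t => propagator H (-t)) (-(propagator H (-t) * (Complex.I • H))) t := by
  have := (hasDerivAt_propagator' H (-t)).scomp t (hasDerivAt_neg t)
  simp only [neg_smul, one_smul] at this
  exact this

lemma norm_propagator_conj {H : Op V} (hH : Hᴴ = H) (t : ℝ) (A : Op V) :
    ‖propagator H t * A * propagator H (-t)‖ = ‖A‖ := by
  rw [norm_mul_unitary, norm_unitary_mul]
  · rw [propagator_conjTranspose hH, propagator_neg_mul]
  · rw [propagator_conjTranspose hH, neg_neg, propagator_neg_mul]

end Propagator

/-! ### The Lieb–Robinson bound by Grönwall's inequality. -/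

section LiebRobinson

open scoped Matrix.Norms.Frobenius

variable {V : Type*} [Fintype V] [DecidableEq V]

lemma norm_conj_propagator {H : Op V} (hH : Hᴴ = H) (t : ℝ) (A : Op V) :
    ‖propagator H (-t) * A * propagator H t‖ = ‖A‖ := by
  simpa using norm_propagator_conj hH (-t) A

lemma hasDerivAt_evolve (H A : Op V) (t : ℝ) :
    HasDerivAt (fun s => evolve H s A)
      (Complex.I • (H * evolve H t A - evolve H t A * H)) t := by
  have h := ((hasDerivAt_propagator H t).mul_const A).mul (hasDerivAt_propagator_neg' H t)
  have e : (fun s => evolve H s A) = fun s => propagator H s * A * propagator H (-s) :=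
    funext fun s => evolve_eq H s A
  rw [e]
  refine HasDerivAt.congr_deriv h ?_
  simp only [evolve_eq, mul_neg, Matrix.smul_mul, Matrix.mul_smul, smul_sub, mul_assoc]
  abel

lemma hasDerivAt_mul_mul {𝔸 : Type*} [NormedRing 𝔸] [NormedAlgebra ℝ 𝔸] {u v w : ℝ → 𝔸}
    {u' v' w' d : 𝔸} {t : ℝ} (hu : HasDerivAt u u' t) (hv : HasDerivAt v v' t)
    (hw : HasDerivAt w w' t) (hd : u' * v t * w t + u t * v' * w t + u t * v t * w' = d) :
    HasDerivAt (fun s => u s * v s * w s) d t :=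
  ((hu.mul hv).mul hw).congr_deriv (by rw [← hd, add_mul]; rfl)

/-- In the frame rotating with `H₀`, the evolution by `H` is generated by `H - H₀`. -/
lemma hasDerivAt_rotated_evolve (H H₀ A : Op V) (t : ℝ) :
    HasDerivAt (fun s => propagator H₀ (-s) * evolve H s A * propagator H₀ s)
      (propagator H₀ (-t) * (Complex.I • ((H - H₀) * evolve H t A - evolve H t A * (H - H₀)))
        * propagator H₀ t) t := by
  refine hasDerivAt_mul_mul (hasDerivAt_propagator_neg' H₀ t) (hasDerivAt_evolve H A t)
    (hasDerivAt_propagator H₀ t) ?_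
  simp only [neg_mul, Matrix.smul_mul, Matrix.mul_smul, smul_sub, mul_assoc, mul_sub, sub_mul]
  abel

lemma hasDerivAt_part {f : ℝ → Op V} {f' : Op V} {t : ℝ} (h : HasDerivAt f f' t) (j : V) :
    HasDerivAt (fun s => part j (f s)) (part j f') t :=
  ((partₗ j).toContinuousLinearMap.restrictScalars ℝ).hasFDerivAt.comp_hasDerivAt t h

lemma part_conj_propagator {j : V} {S : Finset V} {H : Op V} (hH : ActsOn S H) (hj : j ∉ S)
    (s t : ℝ) (A : Op V) :
    part j (propagator H s * A * propagator H t) =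
      propagator H s * part j A * propagator H t := by
  rw [(hH.propagator t).part_mul_right hj, (hH.propagator s).part_mul_left hj]

/-- A Lieb–Robinson bound in Frobenius norm. -/
theorem norm_part_evolve_le (𝒵 : Finset (Finset V)) (h : Finset V → Op V)
    (hact : ∀ Z, ActsOn Z (h Z)) (hherm : ∀ Z, (h Z)ᴴ = h Z) (K : V → V → ℝ)
    (hK : ∀ i j, 0 < K i j) (J lam : ℝ) (hJ : 0 ≤ J)
    (hdecay : ∀ i j, ∑ Z ∈ 𝒵.filter (fun Z => i ∈ Z ∧ j ∈ Z), opNorm (h Z) ≤ J * K i j)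
    (hconv : ∀ i j, ∑ l, K i l * K l j ≤ lam * K i j)
    (A : Op V) (i : V) (a : ℝ) (ha : 0 ≤ a) (hA : ∀ j, ‖part j A‖ ≤ a * K i j)
    (t : ℝ) (ht : 0 ≤ t) (j : V) :
    ‖part j (evolve (∑ Z ∈ 𝒵, h Z) t A)‖ ≤ a * K i j * Real.exp (2 * J * lam * t) := by
  set H := ∑ Z ∈ 𝒵, h Z with hH
  set H₀ : V → Op V := fun j => ∑ Z ∈ 𝒵.filter (fun Z => j ∉ Z), h Z with hH₀
  set H₁ : V → Op V := fun j => ∑ Z ∈ 𝒵.filter (fun Z => j ∈ Z), h Z with hH₁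
  have hsplit : ∀ j, H - H₀ j = H₁ j := fun j => by
    rw [sub_eq_iff_eq_add, hH, hH₀, hH₁]
    exact (Finset.sum_filter_add_sum_filter_not _ _ _).symm
  have hH₀act : ∀ j, ActsOn {j}ᶜ (H₀ j) := fun j => ActsOn.sum fun Z hZ =>
    (hact Z).mono (subset_compl_singleton.2 (Finset.mem_filter.1 hZ).2)
  have hH₀herm : ∀ j, (H₀ j)ᴴ = H₀ j := fun j => by
    simp [hH₀, Matrix.conjTranspose_sum, hherm]
  -- Each component j uses its own rotating frame, which removes all terms not acting at j without
  -- changing the norm of the part at j. The weight K⁻¹ turns the desired profile into a bound on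
  -- the sup norm over j, so Grönwall applies to a single vector-valued function.
  set F : ℝ → V → Op V := fun s j =>
    ((K i j)⁻¹ : ℝ) • part j (propagator (H₀ j) (-s) * evolve H s A * propagator (H₀ j) s) with hF
  set F' : ℝ → V → Op V := fun s j => ((K i j)⁻¹ : ℝ) • part j
    (propagator (H₀ j) (-s) * (Complex.I • (H₁ j * evolve H s A - evolve H s A * H₁ j))
        * propagator (H₀ j) s) with hF'
  have hder : ∀ s, HasDerivAt F (F' s) s := fun s => by
    refine hasDerivAt_pi.2 fun j => ?_
    have := (hasDerivAt_part (hasDerivAt_rotated_evolve H (H₀ j) A s) j).const_smul ((K i j)⁻¹)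
    rw [hsplit j] at this
    exact this
  have hnormF : ∀ s j, ‖F s j‖ = (K i j)⁻¹ * ‖part j (evolve H s A)‖ := fun s j => by
    rw [hF]
    simp only
    rw [norm_smul, part_conj_propagator (hH₀act j) (by simp), norm_conj_propagator (hH₀herm j),
      Real.norm_of_nonneg (inv_nonneg.2 (hK i j).le)]
  have hpart : ∀ s j, ‖part j (evolve H s A)‖ ≤ ‖F s‖ * K i j := fun s j => by
    have h1 := norm_le_pi_norm (F s) j
    rw [hnormF, inv_mul_eq_div, div_le_iff₀ (hK i j)] at h1
    exact h1
  have hlam : ∀ j, 0 ≤ lam * K i j := fun j =>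
    (Finset.sum_nonneg fun l _ => mul_nonneg (hK i l).le (hK l j).le).trans (hconv i j)
  have hlam0 : 0 ≤ lam := nonneg_of_mul_nonneg_left (hlam i) (hK i i)
  have hcomm : ∀ s j, ‖H₁ j * evolve H s A - evolve H s A * H₁ j‖ ≤
      2 * J * lam * ‖F s‖ * K i j := fun s j => by
    set B := evolve H s A with hB
    have e : H₁ j * B - B * H₁ j =
        ∑ Z ∈ 𝒵.filter (fun Z => j ∈ Z), (h Z * B - B * h Z) := by
      rw [Finset.sum_sub_distrib, ← Finset.sum_mul, ← Finset.mul_sum]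
    rw [e]
    calc ‖∑ Z ∈ 𝒵.filter (fun Z => j ∈ Z), (h Z * B - B * h Z)‖
        ≤ ∑ Z ∈ 𝒵.filter (fun Z => j ∈ Z), 2 * opNorm (h Z) * ∑ l ∈ Z, ‖part l B‖ :=
          norm_sum_le_of_le _ fun Z _ => norm_commutator_le (hact Z) B
      -- Regrouping by the site l brings in the decay of the terms containing both l and j; the
      -- convolution bound then closes the estimate.
      _ = ∑ l, 2 * ‖part l B‖ * ∑ Z ∈ 𝒵.filter (fun Z => l ∈ Z ∧ j ∈ Z), opNorm (h Z) := by
          simp only [Finset.mul_sum, Finset.sum_filter]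
          rw [Finset.sum_comm]
          refine Finset.sum_congr rfl fun Z _ => ?_
          by_cases hj : j ∈ Z
          · simp only [hj, if_true, and_true, mul_ite, mul_zero, Finset.sum_ite_mem,
              Finset.univ_inter]
            exact Finset.sum_congr rfl fun l _ => by ring
          · simp [hj]
      _ ≤ ∑ l, 2 * (‖F s‖ * K i l) * (J * K l j) := by
          gcongr with l
          · exact Finset.sum_nonneg fun Z _ => norm_nonneg _
          · have := (hK i l).le; positivity
          · exact hpart s l
          · exact hdecay l j
      _ = 2 * J * ‖F s‖ * ∑ l, K i l * K l j := by
          rw [Finset.mul_sum]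
          exact Finset.sum_congr rfl fun l _ => by ring
      _ ≤ 2 * J * ‖F s‖ * (lam * K i j) := by
          gcongr
          exact hconv i j
      _ = 2 * J * lam * ‖F s‖ * K i j := by ring
  have hbound : ∀ s, ‖F' s‖ ≤ 2 * J * lam * ‖F s‖ + 0 := fun s => by
    rw [add_zero, pi_norm_le_iff_of_nonneg (by positivity)]
    intro j
    rw [hF']
    simp only
    rw [norm_smul, part_conj_propagator (hH₀act j) (by simp), norm_conj_propagator (hH₀herm j),
      Real.norm_of_nonneg (inv_nonneg.2 (hK i j).le), inv_mul_eq_div, div_le_iff₀ (hK i j)]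
    refine (norm_part_le _ _).trans ?_
    rw [norm_smul, Complex.norm_I, one_mul]
    exact hcomm s j
  have h0 : ‖F 0‖ ≤ a := by
    rw [pi_norm_le_iff_of_nonneg ha]
    intro j
    rw [hnormF, inv_mul_eq_div, div_le_iff₀ (hK i j)]
    simpa [evolve_eq, propagator_zero] using hA j
  have hg := norm_le_gronwallBound_of_norm_deriv_right_le (f := F) (f' := F') (a := 0) (b := t)
    (fun s _ => (hder s).continuousAt.continuousWithinAt)
    (fun s _ => (hder s).hasDerivWithinAt) h0 (fun s _ => hbound s) t ⟨ht, le_rfl⟩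
  rw [gronwallBound_ε0, sub_zero] at hg
  calc ‖part j (evolve H t A)‖ ≤ ‖F t‖ * K i j := hpart t j
    _ ≤ a * Real.exp (2 * J * lam * t) * K i j := by
        gcongr
        exact (hK i j).le
    _ = _ := by ring

end LiebRobinson

/-! ### Approximating the interaction-picture propagator by local unitaries. -/

section InteractionPicture

open scoped Matrix.Norms.Frobenius

variable {V : Type*} [Fintype V] [DecidableEq V]

/-- The unitary operators acting on `S`. -/
def localUnitaries (S : Finset V) : Set (Op V) := {u | ActsOn S u ∧ uᴴ * u = 1 ∧ u * uᴴ = 1}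

lemma one_mem_localUnitaries (S : Finset V) : (1 : Op V) ∈ localUnitaries S :=
  ⟨actsOn_one S, by simp, by simp⟩

lemma mul_mem_localUnitaries {S : Finset V} {u v : Op V} (hu : u ∈ localUnitaries S)
    (hv : v ∈ localUnitaries S) : u * v ∈ localUnitaries S := by
  refine ⟨hu.1.mul hv.1, ?_, ?_⟩
  · rw [Matrix.conjTranspose_mul, mul_assoc, ← mul_assoc uᴴ, hu.2.1, one_mul, hv.2.1]
  · rw [Matrix.conjTranspose_mul, mul_assoc, ← mul_assoc v, hv.2.2, one_mul, hu.2.2]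

lemma propagator_mem_localUnitaries {S : Finset V} {H : Op V} (hH : ActsOn S H) (hH' : Hᴴ = H)
    (t : ℝ) : propagator H t ∈ localUnitaries S := by
  refine ⟨hH.propagator t, ?_, ?_⟩
  · rw [propagator_conjTranspose hH', propagator_neg_mul]
  · rw [propagator_conjTranspose hH', propagator_mul_neg]

lemma propagator_conjTranspose_mul {H : Op V} (hH : Hᴴ = H) (t : ℝ) :
    (propagator H t)ᴴ * propagator H t = 1 := by
  rw [propagator_conjTranspose hH, propagator_neg_mul]

/-- The propagator in the interaction picture with respect to `H₀`. -/
def interactionPropagator (H H₀ : Op V) (t : ℝ) : Op V := propagator H t * propagator H₀ (-t)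

lemma interactionPropagator_conjTranspose_mul {H H₀ : Op V} (hH : Hᴴ = H) (hH₀ : H₀ᴴ = H₀)
    (t : ℝ) : (interactionPropagator H H₀ t)ᴴ * interactionPropagator H H₀ t = 1 := by
  rw [interactionPropagator, Matrix.conjTranspose_mul, mul_assoc,
    ← mul_assoc (propagator H t)ᴴ, propagator_conjTranspose_mul hH, one_mul,
    propagator_conjTranspose_mul hH₀]

lemma interactionPropagator_mul_conjTranspose {H H₀ : Op V} (hH : Hᴴ = H) (hH₀ : H₀ᴴ = H₀)
    (t : ℝ) : interactionPropagator H H₀ t * (interactionPropagator H H₀ t)ᴴ = 1 :=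
  mul_eq_one_comm.1 (interactionPropagator_conjTranspose_mul hH hH₀ t)

lemma hasDerivAt_mul_of_eq {𝔸 : Type*} [NormedRing 𝔸] [NormedAlgebra ℝ 𝔸] {u v : ℝ → 𝔸}
    {u' v' d : 𝔸} {t : ℝ} (hu : HasDerivAt u u' t) (hv : HasDerivAt v v' t)
    (hd : u' * v t + u t * v' = d) : HasDerivAt (fun s => u s * v s) d t :=
  (hu.mul hv).congr_deriv hd

lemma hasDerivAt_interactionPropagator (H H₀ : Op V) (t : ℝ) :
    HasDerivAt (interactionPropagator H H₀)
      (interactionPropagator H H₀ t * (Complex.I • evolve H₀ t (H - H₀))) t := by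
  refine hasDerivAt_mul_of_eq (hasDerivAt_propagator' H t) (hasDerivAt_propagator_neg H₀ t) ?_
  have h1 : propagator H₀ (-t) * (propagator H₀ t * ((H - H₀) * propagator H₀ (-t))) =
      (H - H₀) * propagator H₀ (-t) := by
    rw [← mul_assoc, propagator_neg_mul, one_mul]
  simp only [interactionPropagator, evolve_eq, Matrix.mul_smul, mul_assoc, h1]
  simp only [Matrix.smul_mul, Matrix.mul_smul, mul_neg, sub_mul, mul_sub, smul_sub, mul_assoc]
  abel

/-- For u near U the product u E is a competitor for U G. Unitary factors preserve the Frobenius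
norm, so the two errors simply add. -/
lemma infDist_localUnitaries_mul_le {S : Finset V} {U G E : Op V} (hG : G * Gᴴ = 1)
    (hE : E ∈ localUnitaries S) :
    Metric.infDist (U * G) (localUnitaries S) ≤ Metric.infDist U (localUnitaries S) + ‖G - E‖ := by
  rw [← sub_le_iff_le_add, Metric.le_infDist ⟨1, one_mem_localUnitaries S⟩]
  intro u hu
  rw [sub_le_iff_le_add]
  refine (Metric.infDist_le_dist_of_mem (mul_mem_localUnitaries hu hE)).trans ?_
  rw [dist_eq_norm, dist_eq_norm]
  have : U * G - u * E = (U - u) * G + u * (G - E) := by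
    rw [sub_mul, mul_sub]; abel
  rw [this]
  refine (norm_add_le _ _).trans ?_
  rw [norm_mul_unitary hG, norm_unitary_mul hu.2.1]

lemma hasDerivAt_const_mul_sub_comp (x : ℝ) {𝔸 : Type*} [NormedRing 𝔸] [NormedAlgebra ℝ 𝔸] {f g : ℝ → 𝔸}
    {u f' g' : 𝔸} (hf : HasDerivAt f f' x) (hg : HasDerivAt g g' 0) :
    HasDerivAt (fun z => u * f z - g (z - x)) (u * f' - g') x := by
  have h2 : HasDerivAt (fun z => g (z - x)) g' x := by
    have : HasDerivAt g g' (x - x) := by simpa using hg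
    simpa using this.comp_sub_const x x
  exact (hf.const_mul u).sub h2

/-- Following the distance to the set of local unitaries avoids solving the equation with the
truncated, time-dependent generator. From time x to z, a near-optimal unitary is continued by the
exponential of the truncated generator frozen at x, at a cost of η (z - x) to first order. -/
lemma infDist_interactionPropagator_le {R : Finset V} {H H₀ : Op V} (hH : Hᴴ = H)
    (hH₀ : H₀ᴴ = H₀) {t η : ℝ} (ht : 0 ≤ t)
    (hη : ∀ s ∈ Set.Icc 0 t, ‖evolve H₀ s (H - H₀) - localApprox R (evolve H₀ s (H - H₀))‖ ≤ η) :
    Metric.infDist (interactionPropagator H H₀ t) (localUnitaries R) ≤ η * t := by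
  set U := interactionPropagator H H₀ with hU
  set T : ℝ → Op V := fun s => evolve H₀ s (H - H₀) with hT
  have hTh : ∀ s, (T s)ᴴ = T s := fun s => by
    simp only [hT, evolve_eq, Matrix.conjTranspose_mul, propagator_conjTranspose hH₀,
      Matrix.conjTranspose_sub, hH, hH₀, neg_neg, mul_assoc]
  have hcont : ContinuousOn (fun s => Metric.infDist (U s) (localUnitaries R)) (Set.Icc 0 t) :=
    fun s _ => ((Metric.continuous_infDist_pt _).continuousAt.comp
      (hasDerivAt_interactionPropagator H H₀ s).continuousAt).continuousWithinAt
  -- The distance function need not be differentiable; this comparison only requires a bound on the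
  -- lower limit of its right slopes.
  refine image_le_of_liminf_slope_right_le_deriv_boundary (a := 0) (b := t) (B := fun s => η * s)
    (B' := fun _ => η) hcont ?_ (by fun_prop) ?_ ?_ ⟨ht, le_rfl⟩
  · rw [mul_zero]
    refine (Metric.infDist_le_dist_of_mem (one_mem_localUnitaries R)).trans ?_
    simp [hU, interactionPropagator, propagator_zero]
  · intro x _
    simpa using ((hasDerivAt_id x).const_mul η).hasDerivWithinAt
  · intro x hx r hr
    set T' := localApprox R (T x) with hT'
    have hT'h : T'ᴴ = T' := by rw [hT', ← localApprox_conjTranspose, hTh]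
    -- The true increment of U minus its local replacement. Both are 1 at z = x, so the difference
    -- is governed by the generator error T - T'.
    have hd : HasDerivAt (fun z => (U x)ᴴ * U z - propagator T' (z - x))
        (Complex.I • (T x - T')) x := by
      have h1 := hasDerivAt_propagator T' 0
      rw [propagator_zero, mul_one] at h1
      have h2 := hasDerivAt_const_mul_sub_comp x (u := (U x)ᴴ) (hasDerivAt_interactionPropagator H H₀ x) h1
      rw [← mul_assoc, interactionPropagator_conjTranspose_mul hH hH₀, one_mul, ← smul_sub] at h2
      exact h2
    have hlt : ‖Complex.I • (T x - T')‖ < r := by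
      rw [norm_smul, Complex.norm_I, one_mul]
      exact (hη x ⟨hx.1, hx.2.le⟩).trans_lt hr
    refine (hd.hasDerivWithinAt.liminf_right_slope_norm_le hlt).mp ?_
    filter_upwards [self_mem_nhdsWithin] with z hz hlt'
    have hz' : 0 < z - x := sub_pos.2 hz
    have h0 : ‖(U x)ᴴ * U x - propagator T' (x - x)‖ = 0 := by
      rw [interactionPropagator_conjTranspose_mul hH hH₀, sub_self, propagator_zero]
      simp
    rw [h0, sub_zero] at hlt'
    rw [slope_def_field, div_lt_iff₀ hz']
    rw [inv_mul_eq_div, div_lt_iff₀ hz'] at hlt'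
    refine lt_of_le_of_lt ?_ hlt'
    have hUz : U z = U x * ((U x)ᴴ * U z) := by
      rw [← mul_assoc, interactionPropagator_mul_conjTranspose hH hH₀, one_mul]
    have hG : ((U x)ᴴ * U z) * ((U x)ᴴ * U z)ᴴ = 1 := by
      rw [Matrix.conjTranspose_mul, Matrix.conjTranspose_conjTranspose, mul_assoc,
        ← mul_assoc (U z), interactionPropagator_mul_conjTranspose hH hH₀, one_mul,
        interactionPropagator_conjTranspose_mul hH hH₀]
    have := infDist_localUnitaries_mul_le (S := R) (U := U x) hG
      (propagator_mem_localUnitaries (actsOn_localApprox R (T x)) hT'h (z - x))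
    rw [← hUz] at this
    linarith

/-- The competitor is u W u†. Its difference from U W U† splits into two terms, each with one factor
U - u (or its adjoint) in Frobenius norm and the rest of operator norm at most 1. -/
lemma norm_conj_sub_localApprox_le {R : Finset V} {U u W : Op V} (hU : Uᴴ * U = 1)
    (hu : u ∈ localUnitaries R) (hW : ActsOn R W) (hW1 : opNorm W ≤ 1) :
    ‖U * W * Uᴴ - localApprox R (U * W * Uᴴ)‖ ≤ 2 * ‖U - u‖ := by
  have huh : ActsOn R uᴴ := by
    rw [actsOn_iff_localApprox_eq, localApprox_conjTranspose, hu.1.localApprox_eq]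
  have h1 := norm_sub_localApprox_le (A := U * W * Uᴴ) ((hu.1.mul hW).mul huh)
  have h2 : U * W * Uᴴ - u * W * uᴴ = (U - u) * W * Uᴴ + u * (W * (U - u)ᴴ) := by
    rw [Matrix.conjTranspose_sub]
    simp only [sub_mul, mul_sub, mul_assoc]; abel
  have h3 : ‖(U - u) * W * Uᴴ‖ ≤ ‖U - u‖ := by
    rw [norm_mul_unitary (by rwa [Matrix.conjTranspose_conjTranspose])]
    exact (norm_mul_le_mul_opNorm _ _).trans (mul_le_of_le_one_right (norm_nonneg _) hW1)
  have h4 : ‖u * (W * (U - u)ᴴ)‖ ≤ ‖U - u‖ := by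
    rw [norm_unitary_mul hu.2.1]
    refine (norm_mul_le_opNorm_mul _ _).trans ?_
    rw [Matrix.frobenius_norm_conjTranspose]
    exact mul_le_of_le_one_left (norm_nonneg _) hW1
  rw [h2] at h1
  have h5 := norm_add_le ((U - u) * W * Uᴴ) (u * (W * (U - u)ᴴ))
  linarith

/-- If the dynamics is generated by `A` on `Y`, `B` outside `Y`, and `T`, then the leakage of an
evolved operator out of `R ⊇ Y` is controlled by the leakage of `T` under the evolution by `B`. -/
theorem norm_evolve_sub_localApprox_le {Y R : Finset V} (hYR : Y ⊆ R) {A B T W : Op V}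
    (hA : Aᴴ = A) (hB : Bᴴ = B) (hT : Tᴴ = T) (hAY : ActsOn Y A) (hBY : ActsOn Yᶜ B)
    (hW : ActsOn Y W) (hW1 : opNorm W ≤ 1) {t η : ℝ} (ht : 0 ≤ t)
    (hη : ∀ s ∈ Set.Icc 0 t, ‖evolve B s T - localApprox R (evolve B s T)‖ ≤ η) :
    ‖evolve (A + B + T) t W - localApprox R (evolve (A + B + T) t W)‖ ≤ 2 * (η * t) := by
  have hAB : Commute A B := hAY.commute hBY disjoint_compl_right
  have hAB' : (A + B)ᴴ = A + B := by rw [Matrix.conjTranspose_add, hA, hB]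
  have hH : (A + B + T)ᴴ = A + B + T := by rw [Matrix.conjTranspose_add, hAB', hT]
  have hη' : ∀ s ∈ Set.Icc 0 t, ‖evolve (A + B) s ((A + B + T) - (A + B)) -
      localApprox R (evolve (A + B) s ((A + B + T) - (A + B)))‖ ≤ η := by
    intro s hs
    have e : evolve (A + B) s ((A + B + T) - (A + B)) =
        propagator A s * evolve B s T * propagator A (-s) := by
      rw [add_sub_cancel_left, evolve_eq, evolve_eq, propagator_add A B hAB,
        add_comm A B, propagator_add B A hAB.symm]
      simp only [mul_assoc]
    -- Conjugation by A acts inside R, so it commutes with the truncation and preserves the norm of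
    -- the leakage.
    rw [e, ((hAY.mono hYR).propagator _).localApprox_mul_right,
      ((hAY.mono hYR).propagator _).localApprox_mul_left, ← sub_mul, ← mul_sub,
      norm_propagator_conj hA]
    exact hη s hs
  have hdist := infDist_interactionPropagator_le hH hAB' ht hη'
  set U := interactionPropagator (A + B + T) (A + B) t with hU
  set W₀ := propagator A t * W * propagator A (-t) with hW₀
  have hW₀Y : ActsOn R W₀ :=
    (((hAY.propagator t).mul hW).mul (hAY.propagator (-t))).mono hYR
  have hone : ∀ s, opNorm (propagator A s) ≤ 1 := fun s =>
    opNorm_le_one_of_unitary (propagator_conjTranspose_mul hA s)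
  have hW₀1 : opNorm W₀ ≤ 1 := by
    have n0 : ∀ M : Op V, 0 ≤ opNorm M := fun M => norm_nonneg _
    calc opNorm W₀ ≤ opNorm (propagator A t * W) * opNorm (propagator A (-t)) := opNorm_mul_le _ _
      _ ≤ (opNorm (propagator A t) * opNorm W) * opNorm (propagator A (-t)) := by
          gcongr
          · exact n0 _
          · exact opNorm_mul_le _ _
      _ ≤ (1 * 1) * 1 := by
          gcongr
          any_goals exact n0 _
          · exact hone _
          · exact hone _
      _ = 1 := by norm_num
  have hUh : Uᴴ = propagator (A + B) t * propagator (A + B + T) (-t) := by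
    rw [hU, interactionPropagator, Matrix.conjTranspose_mul, propagator_conjTranspose hAB',
      propagator_conjTranspose hH, neg_neg]
  have hWt : evolve (A + B + T) t W = U * W₀ * Uᴴ := by
    have hBW : Commute (propagator B t) W :=
      commute_propagator ((hW.commute hBY disjoint_compl_right).symm) t
    have h1 : propagator (A + B) t * W * propagator (A + B) (-t) = W₀ := by
      rw [propagator_add A B hAB, add_comm A B, propagator_add B A hAB.symm]
      calc propagator A t * propagator B t * W * (propagator B (-t) * propagator A (-t))
          = propagator A t * (propagator B t * W) * propagator B (-t) * propagator A (-t) := by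
            simp only [mul_assoc]
        _ = propagator A t * W * (propagator B t * propagator B (-t)) * propagator A (-t) := by
            rw [hBW.eq]; simp only [mul_assoc]
        _ = W₀ := by rw [propagator_mul_neg, mul_one]
    rw [← h1, hUh, hU, interactionPropagator, evolve_eq]
    calc propagator (A + B + T) t * W * propagator (A + B + T) (-t)
        = propagator (A + B + T) t * (1 * W * 1) * propagator (A + B + T) (-t) := by simp
      _ = _ := by
        rw [← propagator_neg_mul (A + B) t]
        simp only [mul_assoc]
  -- The bound holds for every competitor u, so no nearest unitary has to be chosen.
  have key : ‖evolve (A + B + T) t W - localApprox R (evolve (A + B + T) t W)‖ / 2 ≤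
      Metric.infDist U (localUnitaries R) := by
    rw [Metric.le_infDist ⟨1, one_mem_localUnitaries R⟩]
    intro u hu
    rw [hWt, div_le_iff₀ two_pos, mul_comm, dist_eq_norm]
    exact norm_conj_sub_localApprox_le (interactionPropagator_conjTranspose_mul hH hAB' t) hu
      hW₀Y hW₀1
  linarith

end InteractionPicture

/-! ### Leakage of the evolved operator as a sum over pairs of sites. -/

section Leakage

open scoped Matrix.Norms.Frobenius

variable {V : Type*} [Fintype V] [DecidableEq V]

lemma coeff_term (c : (V → Fin 4) → ℝ) (Z : Finset V) (p : V → Fin 4) :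
    coeff p (term c Z) = if supp p = Z then (c p : ℂ) else 0 := by
  simp only [term, coeff_sum, coeff_smul, coeff_pauliString, mul_ite, mul_one, mul_zero]
  rw [Finset.sum_ite_eq]
  simp

/-- The interaction terms connecting `Y` with its complement. -/
def crossing (Y : Finset V) : Finset (Finset V) :=
  Finset.univ.filter fun Z => ¬ Z ⊆ Y ∧ ¬ Z ⊆ Yᶜ

/-- The interaction terms outside `Y`. -/
def outside (Y : Finset V) : Finset (Finset V) :=
  Finset.univ.filter fun Z => ¬ Z ⊆ Y ∧ Z ⊆ Yᶜ

/-- The interaction terms inside `Y`. -/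
def inside (Y : Finset V) : Finset (Finset V) := Finset.univ.filter fun Z => Z ⊆ Y

/-- The empty set lies in both Y and its complement; it is counted in `inside` only. -/
lemma hamiltonian_eq (c : (V → Fin 4) → ℝ) (Y : Finset V) :
    hamiltonian c = ∑ Z ∈ inside Y, term c Z + ∑ Z ∈ outside Y, term c Z
      + ∑ Z ∈ crossing Y, term c Z := by
  rw [hamiltonian, ← Finset.sum_filter_add_sum_filter_not Finset.univ (fun Z => Z ⊆ Y),
    ← Finset.sum_filter_add_sum_filter_not (Finset.univ.filter fun Z => ¬ Z ⊆ Y)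
      (fun Z => Z ⊆ Yᶜ), Finset.filter_filter, Finset.filter_filter, ← add_assoc]
  rfl

lemma sum_term_conjTranspose (c : (V → Fin 4) → ℝ) (s : Finset (Finset V)) :
    (∑ Z ∈ s, term c Z)ᴴ = ∑ Z ∈ s, term c Z := by
  simp [Matrix.conjTranspose_sum, term_conjTranspose]

/-- The strings of `term c Z` have support exactly Z, so no string of a crossing term fits inside
the complement of Y. -/
lemma localApprox_compl_crossing (c : (V → Fin 4) → ℝ) (Y : Finset V) :
    localApprox Yᶜ (∑ Z ∈ crossing Y, term c Z) = 0 := by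
  refine eq_of_coeff_eq fun p => ?_
  rw [coeff_localApprox]
  have h0 : coeff p (0 : Op V) = 0 := by simp [coeff]
  split_ifs with h
  · rw [coeff_sum, h0]
    refine Finset.sum_eq_zero fun Z hZ => ?_
    rw [coeff_term, if_neg]
    rintro rfl
    exact (Finset.mem_filter.1 hZ).2.2 h
  · exact h0.symm

lemma localApprox_localApprox_comm (S T : Finset V) (A : Op V) :
    localApprox S (localApprox T A) = localApprox T (localApprox S A) := by
  refine eq_of_coeff_eq fun p => ?_
  simp only [coeff_localApprox]
  split_ifs <;> rfl

lemma part_sub_localApprox (i : V) (R : Finset V) (A : Op V) :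
    part i (A - localApprox R A) = part i A - localApprox R (part i A) := by
  refine eq_of_coeff_eq fun p => ?_
  simp only [coeff_part, coeff_sub, coeff_localApprox]
  split_ifs <;> simp

/-- The two-site decomposition of the leakage out of `R` of an operator all of whose Pauli strings
meet `Y`. -/
lemma norm_sub_localApprox_sq_le_sum {Y R : Finset V} {A : Op V} (h : localApprox Yᶜ A = 0) :
    ‖A - localApprox R A‖ ^ 2 ≤ ∑ i ∈ Y, ∑ j ∈ Rᶜ, ‖part j (part i A)‖ ^ 2 := by
  have h1 : localApprox Yᶜ (A - localApprox R A) = 0 := by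
    rw [localApprox_sub, localApprox_localApprox_comm, h]
    simp [← localApproxₗ_apply]
  refine (norm_sq_le_sum_part h1).trans (Finset.sum_le_sum fun i _ => ?_)
  rw [part_sub_localApprox]
  exact norm_sub_localApprox_sq_le R _

/-- Leakage of the evolved operator out of `R ⊇ Y`, in terms of the decay function `K` of the
interaction. -/
theorem frobNorm_evolve_sub_localApprox_le (c : (V → Fin 4) → ℝ) (K : V → V → ℝ)
    (hK : ∀ i j, 0 < K i j) (J lam : ℝ) (hJ : 0 ≤ J) (hlam0 : 0 ≤ lam)
    (hdecay : ∀ i j, ∑ Z ∈ Finset.univ.filter (fun Z : Finset V => i ∈ Z ∧ j ∈ Z),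
      opNorm (term c Z) ≤ J * K i j)
    (hconv : ∀ i j, ∑ l, K i l * K l j ≤ lam * K i j)
    {Y R : Finset V} (hYR : Y ⊆ R) {W : Op V} (hW : ActsOn Y W) (hW1 : opNorm W ≤ 1)
    {t : ℝ} (ht : 0 ≤ t) :
    frobNorm (evolve (hamiltonian c) t W - localApprox R (evolve (hamiltonian c) t W)) ≤
      2 * J * Real.exp (2 * J * lam * t) * t * √(∑ i ∈ Y, ∑ j ∈ Rᶜ, K i j ^ 2) := by
  set n : ℝ := √(2 ^ Fintype.card V) with hn
  have hn0 : 0 < n := by positivity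
  set A := ∑ Z ∈ inside Y, term c Z with hA
  set B := ∑ Z ∈ outside Y, term c Z with hB
  set T := ∑ Z ∈ crossing Y, term c Z with hT
  have hAY : ActsOn Y A := ActsOn.sum fun Z hZ => (actsOn_term c Z).mono (Finset.mem_filter.1 hZ).2
  have hBY : ActsOn Yᶜ B :=
    ActsOn.sum fun Z hZ => (actsOn_term c Z).mono (Finset.mem_filter.1 hZ).2.2
  have hop : ∀ Z, 0 ≤ opNorm (term c Z) := fun Z => norm_nonneg _
  have hdecay' : ∀ 𝒵 : Finset (Finset V), ∀ i j,
      ∑ Z ∈ 𝒵.filter (fun Z => i ∈ Z ∧ j ∈ Z), opNorm (term c Z) ≤ J * K i j := fun 𝒵 i j =>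
    (Finset.sum_le_sum_of_subset_of_nonneg
      (Finset.filter_subset_filter _ (Finset.subset_univ 𝒵)) fun Z _ _ => hop Z).trans (hdecay i j)
  have hpartT : ∀ i j, ‖part j (part i T)‖ ≤ J * n * K i j := fun i j => by
    rw [hT, part_sum, part_sum]
    calc ‖∑ Z ∈ crossing Y, part j (part i (term c Z))‖
        ≤ ∑ Z ∈ crossing Y, (if i ∈ Z ∧ j ∈ Z then opNorm (term c Z) * n else 0) := by
          refine norm_sum_le_of_le _ fun Z _ => ?_
          split_ifs with h
          · exact (norm_part_le _ _).trans ((norm_part_le _ _).trans (norm_le_opNorm _))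
          · by_cases hi : i ∈ Z
            · have hj : j ∉ Z := fun hj => h ⟨hi, hj⟩
              rw [part_part_comm, part_eq_zero (actsOn_term c Z) hj]
              simp [← partₗ_apply]
            · rw [part_eq_zero (actsOn_term c Z) hi]
              simp [← partₗ_apply]
      _ = (∑ Z ∈ (crossing Y).filter (fun Z => i ∈ Z ∧ j ∈ Z), opNorm (term c Z)) * n := by
          rw [Finset.sum_mul, Finset.sum_filter]
      _ ≤ J * K i j * n := by
          gcongr
          exact hdecay' _ i j
      _ = J * n * K i j := by ring
  set S := ∑ i ∈ Y, ∑ j ∈ Rᶜ, K i j ^ 2 with hS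
  have hη : ∀ s ∈ Set.Icc 0 t, ‖evolve B s T - localApprox R (evolve B s T)‖ ≤
      J * n * Real.exp (2 * J * lam * t) * √S := by
    intro s hs
    have h0 : localApprox Yᶜ (evolve B s T) = 0 := by
      rw [evolve_eq, (hBY.propagator _).localApprox_mul_right,
        (hBY.propagator _).localApprox_mul_left, localApprox_compl_crossing]
      simp
    refine le_of_sq_le_sq ((norm_sub_localApprox_sq_le_sum h0).trans ?_) (by positivity)
    rw [mul_pow, Real.sq_sqrt (by positivity), hS, Finset.mul_sum]
    refine Finset.sum_le_sum fun i hi => ?_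
    rw [Finset.mul_sum]
    refine Finset.sum_le_sum fun j _ => ?_
    rw [← mul_pow]
    gcongr
    -- As B does not touch i, taking the part at i commutes with the evolution. The Lieb–Robinson
    -- bound is thus applied to `part i T`, whose initial profile around i is `hpartT`.
    have hi' : i ∉ Yᶜ := by simpa using hi
    rw [evolve_eq, part_conj_propagator hBY hi', ← evolve_eq]
    have := norm_part_evolve_le (outside Y) (term c) (actsOn_term c) (term_conjTranspose c) K hK
      J lam hJ (hdecay' _) hconv (part i T) i (J * n) (by positivity) (hpartT i) s hs.1 j
    refine this.trans ?_
    have hexp : Real.exp (2 * J * lam * s) ≤ Real.exp (2 * J * lam * t) := by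
      gcongr
      exact hs.2
    have := (hK i j).le
    calc J * n * K i j * Real.exp (2 * J * lam * s)
        ≤ J * n * K i j * Real.exp (2 * J * lam * t) := by gcongr
      _ = _ := by ring
  have hmain := norm_evolve_sub_localApprox_le hYR (sum_term_conjTranspose c _)
    (sum_term_conjTranspose c _) (sum_term_conjTranspose c (crossing Y)) hAY hBY hW hW1 ht hη
  rw [hamiltonian_eq c Y, frobNorm_eq, ← hn, div_le_iff₀ hn0]
  refine hmain.trans (le_of_eq ?_)
  ring

end Leakage

/-! ### Neighbourhoods, surfaces and shells. -/

section Distances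

variable {V : Type*} [Fintype V] [DecidableEq V] {G : SimpleGraph V}

lemma distTo_le_iff (hG : G.Connected) {i : V} {S : Finset V} {n : ℕ} :
    distTo G i S ≤ n ↔ ∃ x ∈ S, G.dist i x ≤ n := by
  constructor
  · intro h
    by_contra! hc
    have : ((n + 1 : ℕ) : ℕ∞) ≤ distTo G i S := by
      refine le_iInf₂ fun x hx => ?_
      rw [← (hG.preconnected i x).coe_dist_eq_edist]
      exact_mod_cast hc x hx
    have h2 := this.trans h
    have : n + 1 ≤ n := by exact_mod_cast h2
    omega
  · rintro ⟨x, hx, hn⟩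
    refine (iInf₂_le x hx).trans ?_
    rw [← (hG.preconnected i x).coe_dist_eq_edist]
    exact_mod_cast hn

lemma distTo_eq (hG : G.Connected) {i x : V} {S : Finset V} {n : ℕ} (hx : x ∈ S)
    (hxn : G.dist i x ≤ n) (hmin : ∀ y ∈ S, n ≤ G.dist i y) : distTo G i S = n := by
  refine le_antisymm ((distTo_le_iff hG).2 ⟨x, hx, hxn⟩) (le_iInf₂ fun y hy => ?_)
  rw [← (hG.preconnected i y).coe_dist_eq_edist]
  exact_mod_cast hmin y hy

lemma mem_nbhd (hG : G.Connected) {i : V} {X : Finset V} {n : ℕ} :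
    i ∈ nbhd G X n ↔ ∃ x ∈ X, G.dist i x ≤ n := by
  simp [nbhd, distTo_le_iff hG]

lemma not_mem_nbhd (hG : G.Connected) {i : V} {X : Finset V} {n : ℕ} :
    i ∉ nbhd G X n ↔ ∀ x ∈ X, n < G.dist i x := by
  simp [mem_nbhd hG]

lemma subset_nbhd (hG : G.Connected) (X : Finset V) (n : ℕ) : X ⊆ nbhd G X n := fun i hi =>
  (mem_nbhd hG).2 ⟨i, hi, by simp⟩

lemma nbhd_mono (hG : G.Connected) (X : Finset V) {m n : ℕ} (h : m ≤ n) :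
    nbhd G X m ⊆ nbhd G X n := fun i hi => by
  obtain ⟨x, hx, hd⟩ := (mem_nbhd hG).1 hi
  exact (mem_nbhd hG).2 ⟨x, hx, hd.trans h⟩

/-- A geodesic from `S` to its complement leaves `S` along some edge. -/
lemma exists_exit (hG : G.Connected) {S : Finset V} {i j : V} (hi : i ∈ S) (hj : j ∉ S) :
    ∃ u v, u ∈ S ∧ v ∉ S ∧ G.Adj u v ∧ G.dist i j = G.dist i u + 1 + G.dist v j := by
  induction hn : G.dist i j generalizing i with
  | zero =>
    rw [hG.dist_eq_zero_iff] at hn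
    exact absurd (hn ▸ hi) hj
  | succ n ih =>
    obtain ⟨w, hw⟩ := hG.exists_walk_length_eq_dist i j
    cases w with
    | nil => exact absurd hi hj
    | @cons _ k _ hadj w' =>
      rw [SimpleGraph.Walk.length_cons] at hw
      have h1 : G.dist k j ≤ n := by
        have := SimpleGraph.dist_le w'
        omega
      have hik : G.dist i k = 1 := SimpleGraph.dist_eq_one_iff_adj.2 hadj
      have h2 : G.dist i j ≤ G.dist i k + G.dist k j := hG.dist_triangle
      have h3 : G.dist k j = n := by omega
      by_cases hk : k ∈ S
      · obtain ⟨u, v, hu, hv, huv, hd⟩ := ih hk h3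
        refine ⟨u, v, hu, hv, huv, ?_⟩
        have h4 : G.dist i u ≤ G.dist i k + G.dist k u := hG.dist_triangle
        have h5 : G.dist i j ≤ G.dist i u + G.dist u j := hG.dist_triangle
        have h6 : G.dist u j ≤ G.dist u v + G.dist v j := hG.dist_triangle
        have h7 : G.dist u v = 1 := SimpleGraph.dist_eq_one_iff_adj.2 huv
        omega
      · exact ⟨i, k, hi, hk, hadj, by simp; omega⟩

lemma mem_surface {X : Finset V} {i : V} :
    i ∈ surface G X ↔ i ∈ X ∧ ∃ j, j ∉ X ∧ G.Adj i j := by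
  simp [surface]

lemma exists_surface_between (hG : G.Connected) {X : Finset V} {i j : V} (hi : i ∈ X)
    (hj : j ∉ X) : ∃ u ∈ surface G X, G.dist i u + G.dist u j = G.dist i j := by
  obtain ⟨u, v, hu, hv, huv, hd⟩ := exists_exit hG hi hj
  refine ⟨u, mem_surface.2 ⟨hu, v, hv, huv⟩, ?_⟩
  have h1 : G.dist i j ≤ G.dist i u + G.dist u j := hG.dist_triangle
  have h2 : G.dist u j ≤ G.dist u v + G.dist v j := hG.dist_triangle
  have h3 : G.dist u v = 1 := SimpleGraph.dist_eq_one_iff_adj.2 huv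
  omega

/-- A geodesic from outside to a nearest point of X meets the surface, so the distances to X and to
its surface agree. -/
lemma mem_shell_of_not_mem (hG : G.Connected) {X : Finset V} {i x : V} (hi : i ∉ X) (hx : x ∈ X)
    (hmin : ∀ y ∈ X, G.dist i x ≤ G.dist i y) : i ∈ shell G X (G.dist i x : ℤ) := by
  have hpos : 0 < G.dist i x := hG.pos_dist_of_ne fun h => hi (h ▸ hx)
  have : ¬ ((G.dist i x : ℤ) ≤ 0) := by omega
  simp only [shell, this, if_false, Finset.mem_filter, Finset.mem_compl, hi, not_false_eq_true,
    true_and, Int.natAbs_natCast]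
  obtain ⟨u, hu, hd⟩ := exists_surface_between hG hx hi
  refine distTo_eq hG hu ?_ fun y hy => hmin y (mem_surface.1 hy).1
  rw [G.dist_comm (u := i) (v := u), G.dist_comm (u := i) (v := x)]
  omega

lemma mem_shell_of_mem (hG : G.Connected) {X : Finset V} {i u : V} (hi : i ∈ X)
    (hu : u ∈ surface G X) (hmin : ∀ y ∈ surface G X, G.dist i u ≤ G.dist i y) :
    i ∈ shell G X (-(G.dist i u : ℤ)) := by
  have : -(G.dist i u : ℤ) ≤ 0 := by omega
  simp only [shell, this, if_true, Finset.mem_filter, hi, true_and, Int.natAbs_neg,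
    Int.natAbs_natCast]
  exact distTo_eq hG hu le_rfl hmin

/-- The last site before leaving `X[h]` lies on the shell `(∂X)_h`. -/
lemma mem_shell_of_adj (hG : G.Connected) {X : Finset V} {i j : V} {h : ℕ}
    (hi : i ∈ nbhd G X h) (hj : j ∉ nbhd G X h) (hij : G.Adj i j) :
    i ∈ shell G X (h : ℤ) := by
  obtain ⟨x, hx, hxd⟩ := (mem_nbhd hG).1 hi
  rw [not_mem_nbhd hG] at hj
  have h1 : G.dist j i = 1 := SimpleGraph.dist_eq_one_iff_adj.2 hij.symm
  have hlow : ∀ y ∈ X, h ≤ G.dist i y := fun y hy => by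
    have h2 : G.dist j y ≤ G.dist j i + G.dist i y := hG.dist_triangle
    have := hj y hy
    omega
  have heq : G.dist i x = h := le_antisymm hxd (hlow x hx)
  by_cases hiX : i ∈ X
  · have h0 : h = 0 := by
      have := hlow i hiX
      simpa using this
    have hjX : j ∉ X := fun hjX => by
      have := hj j hjX
      simp at this
    have := mem_shell_of_mem hG hiX (mem_surface.2 ⟨hiX, j, hjX, hij⟩) (by simp)
    simpa [h0] using this
  · rw [← heq]
    exact mem_shell_of_not_mem hG hiX hx fun y hy => heq ▸ hlow y hy

/-- Every site of `X[h]` lies on a shell whose level controls the distance to sites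
outside `X[r]`. -/
lemma exists_level (hG : G.Connected) {X : Finset V} {i j : V} {h r : ℕ}
    (hi : i ∈ nbhd G X h) (hj : j ∉ nbhd G X r) :
    ∃ l : ℤ, l ≤ h ∧ i ∈ shell G X l ∧ (r : ℤ) + 1 - l ≤ G.dist i j := by
  rw [not_mem_nbhd hG] at hj
  obtain ⟨x₀, hx₀, hx₀d⟩ := (mem_nbhd hG).1 hi
  by_cases hiX : i ∈ X
  · have hjX : j ∉ X := fun hjX => by simpa using hj j hjX
    obtain ⟨u, hu, hd⟩ := exists_surface_between hG hiX hjX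
    obtain ⟨u₀, hu₀, hmin⟩ := Finset.exists_min_image (surface G X) (G.dist i) ⟨u, hu⟩
    refine ⟨_, by omega, mem_shell_of_mem hG hiX hu₀ hmin, ?_⟩
    have h1 := hmin u hu
    have h2 := hj u (mem_surface.1 hu).1
    rw [G.dist_comm] at h2
    omega
  · obtain ⟨x, hx, hmin⟩ := Finset.exists_min_image X (G.dist i) ⟨x₀, hx₀⟩
    refine ⟨_, ?_, mem_shell_of_not_mem hG hiX hx hmin, ?_⟩
    · have := hmin x₀ hx₀
      omega
    · have h1 := hj x hx
      have h2 : G.dist j x ≤ G.dist j i + G.dist i x := hG.dist_triangle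
      rw [G.dist_comm (u := j) (v := i)] at h2
      omega

end Distances

/-! ### Counting far pairs when the shells are dominated by the one at level h. -/

section PairCount

variable {V : Type*} [Fintype V] [DecidableEq V]

/-- The pairs of a site of `X[h]` and a site outside `X[r]` at distance `s`. -/
def farPairs (G : SimpleGraph V) (X : Finset V) (h r s : ℕ) : Finset (V × V) :=
  (nbhd G X h ×ˢ (nbhd G X r)ᶜ).filter fun q => G.dist q.1 q.2 = s

lemma mem_farPairs {G : SimpleGraph V} {X : Finset V} {h r s : ℕ} {q : V × V} :
    q ∈ farPairs G X h r s ↔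
      q.1 ∈ nbhd G X h ∧ q.2 ∉ nbhd G X r ∧ G.dist q.1 q.2 = s := by
  simp [farPairs, and_assoc]

/-- By `exists_level` the first site of a pair at distance s lies at a level between r + 1 - s and
h, which leaves s - (r - h) levels. The truncated subtraction is the correct count when this range
is empty. -/
lemma card_farPairs_le_of_shell_le {G : SimpleGraph V} (hG : G.Connected) {X : Finset V}
    {h r s : ℕ} (hhr : h ≤ r) {M : ℝ} (hM : ∀ i, ((sphere G i s).card : ℝ) ≤ M)
    (hM0 : 0 ≤ M)
    (hshell : ∀ l : ℤ, l ≤ (h : ℤ) → (shell G X l).card ≤ (shell G X (h : ℤ)).card) :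
    ((farPairs G X h r s).card : ℝ) ≤ ((s - (r - h) : ℕ) : ℝ) * ((shell G X (h : ℤ)).card * M) := by
  classical
  have hsub : farPairs G X h r s ⊆ (Finset.Icc ((r : ℤ) + 1 - s) h).biUnion fun l =>
      (shell G X l).biUnion fun i => (sphere G i s).image fun j => (i, j) := by
    rintro ⟨i, j⟩ hq
    obtain ⟨hi, hj, hd⟩ := mem_farPairs.1 hq
    obtain ⟨l, hl, hil, hld⟩ := exists_level hG hi hj
    simp only [Finset.mem_biUnion, Finset.mem_image, Finset.mem_Icc]
    refine ⟨l, ⟨?_, hl⟩, i, hil, j, by simpa [sphere] using hd, rfl⟩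
    simp only at hd hld
    omega
  have hcard : ((Finset.Icc ((r : ℤ) + 1 - s) h).card) = s - (r - h) := by
    rw [Int.card_Icc]; omega
  calc ((farPairs G X h r s).card : ℝ)
      ≤ ∑ l ∈ Finset.Icc ((r : ℤ) + 1 - s) h, ∑ i ∈ shell G X l, ((sphere G i s).card : ℝ) := by
        have h1 := (Finset.card_le_card hsub).trans Finset.card_biUnion_le
        have h2 : ∀ l ∈ Finset.Icc ((r : ℤ) + 1 - s) h,
            ((shell G X l).biUnion fun i => (sphere G i s).image fun j => (i, j)).card ≤
              ∑ i ∈ shell G X l, (sphere G i s).card := fun l _ =>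
          Finset.card_biUnion_le.trans (Finset.sum_le_sum fun i _ => Finset.card_image_le)
        exact_mod_cast h1.trans (Finset.sum_le_sum h2)
    _ ≤ ∑ l ∈ Finset.Icc ((r : ℤ) + 1 - s) h, ((shell G X (h : ℤ)).card * M) := by
        refine Finset.sum_le_sum fun l hl => ?_
        refine (Finset.sum_le_sum fun i _ => hM i).trans ?_
        rw [Finset.sum_const, nsmul_eq_mul]
        refine mul_le_mul_of_nonneg_right ?_ hM0
        exact_mod_cast hshell l (Finset.mem_Icc.1 hl).2
    _ = _ := by rw [Finset.sum_const, nsmul_eq_mul, hcard]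

end PairCount

/-! ### Mass transport along geodesics in a homogeneous graph. -/

section MassTransport

variable {W : Type*} [Fintype W] [DecidableEq W]

open scoped Classical in
/-- The geodesics of length `s`. -/
def geodesics (L : SimpleGraph W) (s : ℕ) : Finset (Fin (s + 1) → W) :=
  Finset.univ.filter fun p => ∀ a b : Fin (s + 1), a ≤ b → L.dist (p a) (p b) = (b : ℕ) - a

lemma mem_geodesics {L : SimpleGraph W} {s : ℕ} {p : Fin (s + 1) → W} :
    p ∈ geodesics L s ↔ ∀ a b : Fin (s + 1), a ≤ b → L.dist (p a) (p b) = (b : ℕ) - a := by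
  simp [geodesics]

lemma dist_le_of_adj_succ {L : SimpleGraph W} (hL : L.Connected) {q : ℕ → W} {s : ℕ}
    (hq : ∀ a < s, L.Adj (q a) (q (a + 1))) (a n : ℕ) (h : a + n ≤ s) :
    L.dist (q a) (q (a + n)) ≤ n := by
  induction n with
  | zero => simp
  | succ n ih =>
    have h1 : L.dist (q a) (q (a + (n + 1))) ≤
        L.dist (q a) (q (a + n)) + L.dist (q (a + n)) (q (a + (n + 1))) := hL.dist_triangle
    have h2 := ih (by omega)
    have h3 : L.dist (q (a + n)) (q (a + (n + 1))) = 1 :=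
      SimpleGraph.dist_eq_one_iff_adj.2 (hq (a + n) (by omega))
    omega

lemma exists_geodesic {L : SimpleGraph W} (hL : L.Connected) {x y : W} {s : ℕ}
    (h : L.dist x y = s) : ∃ p ∈ geodesics L s, p 0 = x ∧ p (Fin.last s) = y := by
  obtain ⟨w, hw⟩ := hL.exists_walk_length_eq_dist x y
  have hadj : ∀ a < s, L.Adj (w.getVert a) (w.getVert (a + 1)) := fun a ha =>
    w.adj_getVert_succ (by omega)
  refine ⟨fun a => w.getVert a, mem_geodesics.2 fun a b hab => ?_, by simp, ?_⟩
  · have ha := a.2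
    have hb := b.2
    have hab' : (a : ℕ) ≤ b := hab
    have h1 := dist_le_of_adj_succ hL hadj 0 a (by omega)
    have h2 := dist_le_of_adj_succ hL hadj a (b - a) (by omega)
    have h3 := dist_le_of_adj_succ hL hadj b (s - b) (by omega)
    rw [show (a : ℕ) + (b - a) = b by omega] at h2
    rw [show (b : ℕ) + (s - b) = s by omega] at h3
    rw [zero_add] at h1
    have e1 : w.getVert 0 = x := w.getVert_zero
    have e2 : w.getVert s = y := by rw [← h, ← hw]; exact w.getVert_length
    rw [e1] at h1
    rw [e2] at h3
    have h4 : L.dist x y ≤ L.dist x (w.getVert a) + L.dist (w.getVert a) y := hL.dist_triangle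
    have h5 : L.dist (w.getVert a) y ≤
        L.dist (w.getVert a) (w.getVert b) + L.dist (w.getVert b) y := hL.dist_triangle
    omega
  · simp only [Fin.val_last]
    rw [← h, ← hw]
    exact w.getVert_length

/-- The number of geodesics with the same endpoints. -/
def geodCount (L : SimpleGraph W) {s : ℕ} (p : Fin (s + 1) → W) : ℕ :=
  ((geodesics L s).filter fun q => q 0 = p 0 ∧ q (Fin.last s) = p (Fin.last s)).card

lemma dist_iso {L : SimpleGraph W} (hL : L.Connected) (φ : L ≃g L) (x y : W) :
    L.dist (φ x) (φ y) = L.dist x y := by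
  have key : ∀ (ψ : L ≃g L) (x y : W), L.dist (ψ x) (ψ y) ≤ L.dist x y := fun ψ x y => by
    obtain ⟨w, hw⟩ := hL.exists_walk_length_eq_dist x y
    rw [← hw, ← SimpleGraph.Walk.length_map ψ.toHom w]
    exact SimpleGraph.dist_le _
  refine le_antisymm (key φ x y) ?_
  have := key φ.symm (φ x) (φ y)
  simpa using this

lemma comp_mem_geodesics {L : SimpleGraph W} (hL : L.Connected) (φ : L ≃g L) {s : ℕ}
    {p : Fin (s + 1) → W} : (fun a => φ (p a)) ∈ geodesics L s ↔ p ∈ geodesics L s := by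
  simp only [mem_geodesics, dist_iso hL]

lemma geodCount_comp {L : SimpleGraph W} (hL : L.Connected) (φ : L ≃g L) {s : ℕ}
    (p : Fin (s + 1) → W) : geodCount L (fun a => φ (p a)) = geodCount L p := by
  refine (Finset.card_bij (fun q _ => fun a => φ (q a)) ?_ ?_ ?_).symm
  · intro q hq
    simp only [Finset.mem_filter] at hq ⊢
    exact ⟨(comp_mem_geodesics hL φ).2 hq.1, by rw [hq.2.1], by rw [hq.2.2]⟩
  · intro q _ q' _ h
    funext a
    exact φ.injective (congrFun h a)
  · intro q hq
    simp only [Finset.mem_filter] at hq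
    refine ⟨fun a => φ.symm (q a), ?_, by funext a; simp⟩
    simp only [Finset.mem_filter]
    refine ⟨(comp_mem_geodesics hL φ.symm).2 hq.1, ?_, ?_⟩
    · rw [hq.2.1]; simp
    · rw [hq.2.2]; simp

/-- The expected number of geodesics that are at `v` after `a` steps, if one geodesic is chosen
uniformly for each pair of endpoints at distance `s`. -/
def traffic (L : SimpleGraph W) (s : ℕ) (a : Fin (s + 1)) (v : W) : ℝ :=
  ∑ p ∈ (geodesics L s).filter (fun p => p a = v), ((geodCount L p : ℝ))⁻¹

lemma traffic_iso {L : SimpleGraph W} (hL : L.Connected) (φ : L ≃g L) (s : ℕ)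
    (a : Fin (s + 1)) (v : W) : traffic L s a (φ v) = traffic L s a v := by
  refine (Finset.sum_bij (fun q _ => fun a => φ (q a)) ?_ ?_ ?_ ?_).symm
  · intro q hq
    simp only [Finset.mem_filter] at hq ⊢
    exact ⟨(comp_mem_geodesics hL φ).2 hq.1, by rw [hq.2]⟩
  · intro q _ q' _ h
    funext a
    exact φ.injective (congrFun h a)
  · intro q hq
    simp only [Finset.mem_filter] at hq
    refine ⟨fun a => φ.symm (q a), ?_, by funext a; simp⟩
    simp only [Finset.mem_filter]
    exact ⟨(comp_mem_geodesics hL φ.symm).2 hq.1, by rw [hq.2]; simp⟩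
  · intro q _
    rw [geodCount_comp hL]

/-- The weights are uniform probabilities on the nonempty set of geodesics of each pair, so every
pair contributes total weight 1. -/
lemma sum_geodesics_eq_card {L : SimpleGraph W} (hL : L.Connected) {s : ℕ}
    (P : Finset (W × W)) (hP : ∀ q ∈ P, L.dist q.1 q.2 = s) :
    ∑ p ∈ (geodesics L s).filter (fun p => (p 0, p (Fin.last s)) ∈ P), ((geodCount L p : ℝ))⁻¹ =
      P.card := by
  rw [← Finset.sum_fiberwise_of_maps_to (t := P)
    (g := fun p : Fin (s + 1) → W => (p 0, p (Fin.last s)))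
    (fun p hp => (Finset.mem_filter.1 hp).2), Finset.card_eq_sum_ones, Nat.cast_sum]
  refine Finset.sum_congr rfl fun q hq => ?_
  obtain ⟨p₀, hp₀, h0, h1⟩ := exists_geodesic hL (hP q hq)
  have hset : ((geodesics L s).filter (fun p => (p 0, p (Fin.last s)) ∈ P)).filter
      (fun p => (p 0, p (Fin.last s)) = q) =
      (geodesics L s).filter fun p => p 0 = p₀ 0 ∧ p (Fin.last s) = p₀ (Fin.last s) := by
    ext p
    simp only [Finset.mem_filter, h0, h1]
    constructor
    · rintro ⟨⟨hp, _⟩, rfl⟩; exact ⟨hp, rfl, rfl⟩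
    · rintro ⟨hp, h2, h3⟩
      have : (p 0, p (Fin.last s)) = q := Prod.ext h2 h3
      exact ⟨⟨hp, this ▸ hq⟩, this⟩
  rw [hset]
  have hconst : ∀ p ∈ (geodesics L s).filter
      (fun p => p 0 = p₀ 0 ∧ p (Fin.last s) = p₀ (Fin.last s)),
      ((geodCount L p : ℝ))⁻¹ = ((geodCount L p₀ : ℝ))⁻¹ := fun p hp => by
    obtain ⟨-, h2, h3⟩ := Finset.mem_filter.1 hp
    rw [geodCount, geodCount, h2, h3]
  rw [Finset.sum_congr rfl hconst, Finset.sum_const, nsmul_eq_mul]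
  have hpos : (geodCount L p₀ : ℝ) ≠ 0 := by
    have : 0 < geodCount L p₀ := Finset.card_pos.2 ⟨p₀, by simp [hp₀]⟩
    exact_mod_cast this.ne'
  rw [← geodCount, mul_inv_cancel₀ hpos]
  simp

/-- In a homogeneous graph the traffic through each site is at most the size of a sphere. -/
lemma traffic_le {L : SimpleGraph W} (hL : L.Connected) (hom : IsHomogeneous L) {s : ℕ} {M : ℝ}
    (hM : ∀ x, ((sphere L x s).card : ℝ) ≤ M) (a : Fin (s + 1)) (v : W) :
    traffic L s a v ≤ M := by
  classical
  have hconst : ∀ u, traffic L s a u = traffic L s a v := fun u => by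
    obtain ⟨φ, rfl⟩ := hom v u
    exact traffic_iso hL φ s a v
  -- At a fixed time every geodesic is at exactly one site, so the total traffic is the number of
  -- ordered pairs at distance s. As the traffic is constant over the sites, it equals the average
  -- sphere size.
  have htot : ∑ u, traffic L s a u = ∑ x, ((sphere L x s).card : ℝ) := by
    have h1 : ∑ u, traffic L s a u = ∑ p ∈ geodesics L s, ((geodCount L p : ℝ))⁻¹ :=
      Finset.sum_fiberwise _ _ _
    have h2 := sum_geodesics_eq_card hL (s := s)
      (Finset.univ.filter fun q : W × W => L.dist q.1 q.2 = s) (by simp)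
    have h3 : (geodesics L s).filter (fun p => (p 0, p (Fin.last s)) ∈
        Finset.univ.filter fun q : W × W => L.dist q.1 q.2 = s) = geodesics L s := by
      refine Finset.filter_true_of_mem fun p hp => ?_
      simpa using mem_geodesics.1 hp 0 (Fin.last s) (Fin.zero_le _)
    rw [h3] at h2
    rw [h1, h2]
    have h4 : (Finset.univ.filter fun q : W × W => L.dist q.1 q.2 = s) =
        (Finset.univ.sigma fun x => sphere L x s).map
          (Equiv.sigmaEquivProd W W).toEmbedding := by
      ext ⟨x, y⟩
      simp [sphere]
    rw [h4, Finset.card_map, Finset.card_sigma]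
    push_cast
    rfl
  simp only [hconst, Finset.sum_const, nsmul_eq_mul] at htot
  have hle : (Finset.univ : Finset W).card * traffic L s a v ≤ (Finset.univ : Finset W).card * M := by
    rw [htot]
    refine (Finset.sum_le_sum fun x _ => hM x).trans ?_
    rw [Finset.sum_const, nsmul_eq_mul]
  refine le_of_mul_le_mul_left hle ?_
  exact_mod_cast Finset.card_pos.2 ⟨v, Finset.mem_univ v⟩

/-- Mass transport: if all geodesics between the pairs in `P` meet `B` at one of the times in `T`,
then the number of pairs is at most the traffic through `B` at these times. -/
lemma card_pairs_le {L : SimpleGraph W} (hL : L.Connected) (hom : IsHomogeneous L) {s : ℕ} {M : ℝ}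
    (hM : ∀ x, ((sphere L x s).card : ℝ) ≤ M) (P : Finset (W × W))
    (hP : ∀ q ∈ P, L.dist q.1 q.2 = s) (T : Finset (Fin (s + 1))) (B : Finset W)
    (hB : ∀ p ∈ geodesics L s, (p 0, p (Fin.last s)) ∈ P → ∃ a ∈ T, p a ∈ B) :
    (P.card : ℝ) ≤ T.card * (B.card * M) := by
  rw [← sum_geodesics_eq_card hL P hP]
  calc ∑ p ∈ (geodesics L s).filter (fun p => (p 0, p (Fin.last s)) ∈ P), ((geodCount L p : ℝ))⁻¹
      ≤ ∑ p ∈ geodesics L s, ∑ a ∈ T, ∑ v ∈ B,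
          if p a = v then ((geodCount L p : ℝ))⁻¹ else 0 := by
        rw [Finset.sum_filter]
        refine Finset.sum_le_sum fun p hp => ?_
        have hnn : ∀ a v, (0 : ℝ) ≤ if p a = v then ((geodCount L p : ℝ))⁻¹ else 0 :=
          fun a v => by positivity
        split_ifs with hpP
        · obtain ⟨a, ha, hv⟩ := hB p hp hpP
          refine le_trans ?_ (Finset.single_le_sum
            (fun a _ => Finset.sum_nonneg fun v _ => hnn a v) ha)
          refine le_trans ?_ (Finset.single_le_sum (fun v _ => hnn a v) hv)
          simp
        · exact Finset.sum_nonneg fun a _ => Finset.sum_nonneg fun v _ => hnn a v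
    _ = ∑ a ∈ T, ∑ v ∈ B, traffic L s a v := by
        rw [Finset.sum_comm]
        refine Finset.sum_congr rfl fun a _ => ?_
        rw [Finset.sum_comm]
        refine Finset.sum_congr rfl fun v _ => ?_
        rw [traffic, Finset.sum_filter]
    _ ≤ ∑ a ∈ T, ∑ v ∈ B, M := by
        gcongr with a _ v _
        exact traffic_le hL hom hM a v
    _ = _ := by simp

end MassTransport

/-! ### Counting far pairs in a convex region of a homogeneous lattice. -/

section LatticeRegion

variable {V : Type*} [Fintype V] [DecidableEq V] {W : Type*} [Fintype W] [DecidableEq W]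

/-- A geodesic of the ambient graph between two points of a convex region stays in the region. -/
lemma exists_lift_geodesic {G : SimpleGraph V} {L : SimpleGraph W} (f : G ↪g L)
    (hconv : ∀ (i j : V) (v : W),
      L.dist (f i) v + L.dist v (f j) = L.dist (f i) (f j) → v ∈ Set.range f)
    {s : ℕ} {p : Fin (s + 1) → W} (hp : p ∈ geodesics L s) {i j : V} (h0 : p 0 = f i)
    (h1 : p (Fin.last s) = f j) :
    ∃ q : ℕ → V, (∀ a : Fin (s + 1), f (q a) = p a) ∧ q 0 = i ∧ q s = j ∧
      ∀ a < s, G.Adj (q a) (q (a + 1)) := by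
  rw [mem_geodesics] at hp
  have hr : ∀ a : Fin (s + 1), ∃ v, f v = p a := fun a => by
    refine hconv i j (p a) ?_
    rw [← h0, ← h1, hp 0 a (Fin.zero_le a), hp a (Fin.last s) (Fin.le_last a),
      hp 0 (Fin.last s) (Fin.zero_le _)]
    have := a.2
    simp
    omega
  choose q hq using hr
  have hq' : ∀ a : Fin (s + 1), f (if h : (a : ℕ) < s + 1 then q ⟨a, h⟩ else i) = p a := fun a => by
    rw [dif_pos a.2]; exact hq a
  refine ⟨fun a => if h : a < s + 1 then q ⟨a, h⟩ else i, hq', ?_, ?_, fun a ha => ?_⟩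
  · exact f.injective (by rw [← h0]; exact hq' 0)
  · exact f.injective (by rw [← h1]; exact hq' (Fin.last s))
  · rw [← f.map_adj_iff]
    have e1 := hq' ⟨a, by omega⟩
    have e2 := hq' ⟨a + 1, by omega⟩
    simp only at e1 e2 ⊢
    rw [e1, e2, ← SimpleGraph.dist_eq_one_iff_adj, hp _ _ (by simp [Fin.le_def])]
    simp

lemma dist_embedding {G : SimpleGraph V} (hG : G.Connected) {L : SimpleGraph W}
    (hL : L.Connected) (f : G ↪g L)
    (hconv : ∀ (i j : V) (v : W),
      L.dist (f i) v + L.dist v (f j) = L.dist (f i) (f j) → v ∈ Set.range f) (i j : V) :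
    L.dist (f i) (f j) = G.dist i j := by
  refine le_antisymm ?_ ?_
  · obtain ⟨w, hw⟩ := hG.exists_walk_length_eq_dist i j
    rw [← hw, ← SimpleGraph.Walk.length_map f.toHom w]
    exact SimpleGraph.dist_le _
  · obtain ⟨p, hp, h0, h1⟩ := exists_geodesic hL (x := f i) (y := f j) rfl
    obtain ⟨q, -, hq0, hqs, hadj⟩ := exists_lift_geodesic f hconv hp h0 h1
    have := dist_le_of_adj_succ hG hadj 0 _ (by rw [zero_add])
    rwa [zero_add, hq0, hqs] at this

/-- Convexity keeps ambient geodesics inside the region, and each one must leave X[h] through the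
shell at level h. If it leaves after time a, then r < (s - a) + h, so only s - (r - h) times can
occur; `card_pairs_le` then applies. -/
lemma card_farPairs_le_of_region {G : SimpleGraph V} (hG : G.Connected) {L : SimpleGraph W}
    (hL : L.Connected) (hom : IsHomogeneous L) (f : G ↪g L)
    (hconv : ∀ (i j : V) (v : W),
      L.dist (f i) v + L.dist v (f j) = L.dist (f i) (f j) → v ∈ Set.range f)
    {X : Finset V} {h r s : ℕ} (hhr : h ≤ r) {M : ℝ}
    (hM : ∀ x, ((sphere L x s).card : ℝ) ≤ M) (hM0 : 0 ≤ M) :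
    ((farPairs G X h r s).card : ℝ) ≤ ((s - (r - h) : ℕ) : ℝ) * ((shell G X (h : ℤ)).card * M) := by
  set T : Finset (Fin (s + 1)) := Finset.univ.filter fun a => (a : ℕ) < s - (r - h) with hT
  set B : Finset W := (shell G X (h : ℤ)).map f.toEmbedding with hB
  have hTcard : T.card ≤ s - (r - h) := by
    have := Finset.card_le_card_of_injOn (s := T) (t := Finset.range (s - (r - h)))
      (fun a : Fin (s + 1) => (a : ℕ)) (fun a ha => by simpa [hT] using ha)
      (fun a _ b _ hab => Fin.ext hab)
    simpa using this
  have hmain := card_pairs_le hL hom hM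
    ((farPairs G X h r s).map (f.toEmbedding.prodMap f.toEmbedding)) ?_ T B ?_
  · rw [Finset.card_map, hB, Finset.card_map] at hmain
    refine hmain.trans ?_
    gcongr
  · intro q hq
    obtain ⟨⟨i, j⟩, hij, rfl⟩ := Finset.mem_map.1 hq
    exact (dist_embedding hG hL f hconv i j).trans (mem_farPairs.1 hij).2.2
  · intro p hp hpP
    obtain ⟨⟨i, j⟩, hij, he⟩ := Finset.mem_map.1 hpP
    obtain ⟨hi, hj, hd⟩ := mem_farPairs.1 hij
    obtain ⟨h0, h1⟩ := Prod.ext_iff.1 he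
    obtain ⟨q, hq, hq0, hqs, hadj⟩ := exists_lift_geodesic f hconv hp (i := i) (j := j)
      h0.symm h1.symm
    have hjh : j ∉ nbhd G X h := fun hc => hj (nbhd_mono hG X hhr hc)
    have hex : ∃ a, a < s ∧ q a ∈ nbhd G X h ∧ q (a + 1) ∉ nbhd G X h := by
      by_contra! hc
      have : ∀ a ≤ s, q a ∈ nbhd G X h := fun a => by
        induction a with
        | zero => intro _; rw [hq0]; exact hi
        | succ a ih => intro ha; exact hc a (by omega) (ih (by omega))
      exact hjh (hqs ▸ this s le_rfl)
    obtain ⟨a, has, ha1, ha2⟩ := hex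
    have hshell := mem_shell_of_adj hG ha1 ha2 (hadj a has)
    refine ⟨⟨a, by omega⟩, ?_, ?_⟩
    · simp only [hT, Finset.mem_filter, Finset.mem_univ, true_and]
      obtain ⟨x, hx, hxd⟩ := (mem_nbhd hG).1 ha1
      have h3 := dist_le_of_adj_succ hG hadj a (s - a) (by omega)
      rw [show a + (s - a) = s by omega, hqs] at h3
      have h4 : r < G.dist j x := (not_mem_nbhd hG).1 hj x hx
      have h5 : G.dist j x ≤ G.dist j (q a) + G.dist (q a) x := hG.dist_triangle
      rw [G.dist_comm (u := j) (v := q a)] at h5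
      omega
    · rw [hB, ← hq ⟨a, by omega⟩]
      exact Finset.mem_map_of_mem f.toEmbedding hshell

end LatticeRegion

/-- The number of pairs of a site of `X[⌊r/2⌋]` and a site outside `X[r]` at distance `s`. -/
theorem card_farPairs_le {V : Type*} [Fintype V] [DecidableEq V] {G : SimpleGraph V}
    (hG : G.Connected) {D : ℕ} {γ : ℝ} (hγ : 1 ≤ γ) (hlat : IsLatticeConstant G D γ)
    {X : Finset V} {h r : ℕ} (hhr : h ≤ r)
    (hreg : IsLatticeRegion G D γ ∨
      ∀ l : ℤ, l ≤ (h : ℤ) → (shell G X l).card ≤ (shell G X (h : ℤ)).card)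
    {s : ℕ} (hs : 1 ≤ s) :
    ((farPairs G X h r s).card : ℝ) ≤
      ((s - (r - h) : ℕ) : ℝ) * ((shell G X (h : ℤ)).card * (γ * (s : ℝ) ^ ((D : ℝ) - 1))) := by
  have hM0 : 0 ≤ γ * (s : ℝ) ^ ((D : ℝ) - 1) := by positivity
  rcases hreg with ⟨N, L, f, hL, hom, hLlat, hconv⟩ | hshell
  · exact card_farPairs_le_of_region hG hL hom f hconv hhr (fun x => (hLlat x s hs).2) hM0
  · exact card_farPairs_le_of_shell_le hG hhr (fun i => (hlat i s hs).2) hM0 hshell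

/-! ### Power sums by telescoping. -/

section Sums

/-- Comparison of a term with the integral over the preceding unit interval, obtained from
log((x+1)/x) ≥ 1/(x+1) and exp y ≥ 1 + y. -/
lemma mul_rpow_succ_le_sub {p x : ℝ} (hp : 0 < p) (hx : 0 < x) :
    p * (x + 1) ^ (-(p + 1)) ≤ x ^ (-p) - (x + 1) ^ (-p) := by
  have hx1 : 0 < x + 1 := by linarith
  have h1 : x ^ (-p) = (x + 1) ^ (-p) * Real.exp (p * (Real.log (x + 1) - Real.log x)) := by
    rw [Real.rpow_def_of_pos hx, Real.rpow_def_of_pos hx1, ← Real.exp_add]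
    congr 1; ring
  have h2 : 1 / (x + 1) ≤ Real.log (x + 1) - Real.log x := by
    have := Real.log_le_sub_one_of_pos (x := x / (x + 1)) (by positivity)
    rw [Real.log_div hx.ne' hx1.ne'] at this
    have e : x / (x + 1) - 1 = -(1 / (x + 1)) := by field_simp; ring
    linarith
  have h3 : 1 + p * (1 / (x + 1)) ≤ Real.exp (p * (Real.log (x + 1) - Real.log x)) := by
    have := Real.add_one_le_exp (p * (Real.log (x + 1) - Real.log x))
    have := mul_le_mul_of_nonneg_left h2 hp.le
    linarith
  have h4 : (x + 1) ^ (-(p + 1)) = (x + 1) ^ (-p) * (1 / (x + 1)) := by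
    rw [neg_add, Real.rpow_add hx1, Real.rpow_neg_one, one_div]
  rw [h1, h4]
  have h5 := mul_le_mul_of_nonneg_left h3 (Real.rpow_nonneg hx1.le (-p))
  nlinarith

lemma sum_mul_rpow_le {κ : ℝ} (hκ : 0 < κ) {m : ℕ} (hm : 1 ≤ m) (n : ℕ) :
    ∑ u ∈ Finset.range n, (u : ℝ) * ((m : ℝ) + u + 1) ^ (-(κ + 2)) ≤
      (m : ℝ) ^ (-κ) / (κ * (κ + 1)) := by
  have hm' : (1 : ℝ) ≤ m := by exact_mod_cast hm
  -- The subtracted quantity is the integral of u (m+u)^(-κ-2) from n to infinity, computed by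
  -- parts. Retaining it makes the induction close.
  have key : ∑ u ∈ Finset.range n, (u : ℝ) * ((m : ℝ) + u + 1) ^ (-(κ + 2)) ≤
      (m : ℝ) ^ (-κ) / (κ * (κ + 1)) - (n * (((m : ℝ) + n) ^ (-(κ + 1)) / (κ + 1)) +
        ((m : ℝ) + n) ^ (-κ) / (κ * (κ + 1))) := by
    induction n with
    | zero => simp
    | succ n ih =>
      rw [Finset.sum_range_succ]
      have hx : 0 < (m : ℝ) + n := by positivity
      have h1 := mul_rpow_succ_le_sub (p := κ + 1) (by linarith) hx
      have h2 := mul_rpow_succ_le_sub hκ hx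
      rw [show κ + 1 + 1 = κ + 2 by ring] at h1
      push_cast
      rw [← add_assoc]
      set a := ((m : ℝ) + n + 1) ^ (-(κ + 2))
      set b := ((m : ℝ) + n + 1) ^ (-(κ + 1))
      set b' := ((m : ℝ) + n) ^ (-(κ + 1))
      set d := ((m : ℝ) + n + 1) ^ (-κ)
      set d' := ((m : ℝ) + n) ^ (-κ)
      have h1' : (n : ℝ) * a ≤ n * (b' / (κ + 1)) - n * (b / (κ + 1)) := by
        rw [← mul_sub, ← sub_div]
        gcongr
        rw [le_div_iff₀ (by linarith)]
        linarith
      have h2' : b / (κ + 1) ≤ d' / (κ * (κ + 1)) - d / (κ * (κ + 1)) := by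
        rw [← sub_div, div_le_div_iff₀ (by positivity) (by positivity)]
        nlinarith
      linarith
  refine key.trans ?_
  have : 0 ≤ n * (((m : ℝ) + n) ^ (-(κ + 1)) / (κ + 1)) +
        ((m : ℝ) + n) ^ (-κ) / (κ * (κ + 1)) := by positivity
  linarith

lemma sum_tsub_mul_rpow_le {κ : ℝ} (hκ : 0 < κ) {m : ℕ} (hm : 1 ≤ m) (N : ℕ) :
    ∑ s ∈ Finset.range N, ((s - m : ℕ) : ℝ) * ((s : ℝ) + 1) ^ (-(κ + 2)) ≤
      (m : ℝ) ^ (-κ) / (κ * (κ + 1)) := by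
  calc ∑ s ∈ Finset.range N, ((s - m : ℕ) : ℝ) * ((s : ℝ) + 1) ^ (-(κ + 2))
      ≤ ∑ s ∈ Finset.range (m + N), ((s - m : ℕ) : ℝ) * ((s : ℝ) + 1) ^ (-(κ + 2)) :=
        Finset.sum_le_sum_of_subset_of_nonneg (Finset.range_mono (by omega))
          fun _ _ _ => by positivity
    _ = ∑ u ∈ Finset.range N, (u : ℝ) * ((m : ℝ) + u + 1) ^ (-(κ + 2)) := by
        rw [Finset.sum_range_add, Finset.sum_eq_zero, zero_add]
        · simp
        · intro s hs
          have : s - m = 0 := by have := Finset.mem_range.1 hs; omega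
          simp [this]
    _ ≤ _ := sum_mul_rpow_le hκ hm N

end Sums

/-! ### Summing the squared decay, reversing time and fitting the constant. -/

section Main

variable {V : Type*} [Fintype V] [DecidableEq V]

/-- Pairs are grouped by distance. Sphere growth s^(D-1) times (s+1)^(-2α) is at most
(s+1)^(-(κ+2)), while the number of levels or times supplies the linear factor. -/
lemma sum_decay_sq_le {G : SimpleGraph V} (hG : G.Connected) {D : ℕ} (hD : 1 ≤ D) {γ : ℝ}
    (hγ : 1 ≤ γ) (hlat : IsLatticeConstant G D γ) {α : ℝ} (hα : (D : ℝ) < α)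
    {X : Finset V} {h r : ℕ} (hhr : h < r)
    (hreg : IsLatticeRegion G D γ ∨
      ∀ l : ℤ, l ≤ (h : ℤ) → (shell G X l).card ≤ (shell G X (h : ℤ)).card) :
    ∑ i ∈ nbhd G X h, ∑ j ∈ (nbhd G X r)ᶜ, (((G.dist i j : ℝ) + 1) ^ (-α)) ^ 2 ≤
      (shell G X (h : ℤ)).card * γ * (((r - h : ℕ) : ℝ) ^ (-(2 * α - D - 1)) /
        ((2 * α - D - 1) * (2 * α - D - 1 + 1))) := by
  have hD' : (1 : ℝ) ≤ D := by exact_mod_cast hD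
  set κ := 2 * α - D - 1 with hκ
  have hκ0 : 0 < κ := by rw [hκ]; linarith
  set N := (Finset.univ.sup fun q : V × V => G.dist q.1 q.2) + 1 with hN
  have hfib : ∀ s, (nbhd G X h ×ˢ (nbhd G X r)ᶜ).filter (fun q => G.dist q.1 q.2 = s) =
      farPairs G X h r s := fun s => rfl
  rw [← Finset.sum_product', ← Finset.sum_fiberwise_of_maps_to (t := Finset.range N)
    (g := fun q : V × V => G.dist q.1 q.2) (fun q _ => by
      rw [Finset.mem_range, hN, Nat.lt_succ_iff]
      exact Finset.le_sup (f := fun q : V × V => G.dist q.1 q.2) (Finset.mem_univ q))]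
  calc ∑ s ∈ Finset.range N, ∑ q ∈ (nbhd G X h ×ˢ (nbhd G X r)ᶜ) with G.dist q.1 q.2 = s,
        (((G.dist q.1 q.2 : ℝ) + 1) ^ (-α)) ^ 2
      = ∑ s ∈ Finset.range N, (farPairs G X h r s).card * (((s : ℝ) + 1) ^ (-α)) ^ 2 := by
        refine Finset.sum_congr rfl fun s _ => ?_
        rw [hfib, ← nsmul_eq_mul, ← Finset.sum_const]
        refine Finset.sum_congr rfl fun q hq => ?_
        rw [(mem_farPairs.1 hq).2.2]
    _ ≤ ∑ s ∈ Finset.range N, (shell G X (h : ℤ)).card * γ *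
          (((s - (r - h) : ℕ) : ℝ) * ((s : ℝ) + 1) ^ (-(κ + 2))) := by
        refine Finset.sum_le_sum fun s _ => ?_
        rcases Nat.eq_zero_or_pos s with rfl | hs
        · have : farPairs G X h r 0 = ∅ := by
            refine Finset.eq_empty_of_forall_notMem fun q hq => ?_
            obtain ⟨h1, h2, h3⟩ := mem_farPairs.1 hq
            rw [hG.dist_eq_zero_iff] at h3
            exact h2 (h3 ▸ nbhd_mono hG X hhr.le h1)
          simp [this]
        · have hs1 : (0 : ℝ) < (s : ℝ) + 1 := by positivity
          have hcard := card_farPairs_le hG hγ hlat hhr.le hreg hs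
          have hpow : (s : ℝ) ^ ((D : ℝ) - 1) * (((s : ℝ) + 1) ^ (-α)) ^ 2 ≤
              ((s : ℝ) + 1) ^ (-(κ + 2)) := by
            calc (s : ℝ) ^ ((D : ℝ) - 1) * (((s : ℝ) + 1) ^ (-α)) ^ 2
                ≤ ((s : ℝ) + 1) ^ ((D : ℝ) - 1) * (((s : ℝ) + 1) ^ (-α)) ^ 2 := by
                  gcongr
                  linarith
              _ = ((s : ℝ) + 1) ^ (-(κ + 2)) := by
                  rw [← Real.rpow_natCast, ← Real.rpow_mul hs1.le, ← Real.rpow_add hs1, hκ]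
                  congr 1
                  push_cast
                  ring
          calc ((farPairs G X h r s).card : ℝ) * (((s : ℝ) + 1) ^ (-α)) ^ 2
              ≤ (((s - (r - h) : ℕ) : ℝ) * ((shell G X (h : ℤ)).card *
                  (γ * (s : ℝ) ^ ((D : ℝ) - 1)))) * (((s : ℝ) + 1) ^ (-α)) ^ 2 := by
                gcongr
            _ = (shell G X (h : ℤ)).card * γ * (((s - (r - h) : ℕ) : ℝ) *
                  ((s : ℝ) ^ ((D : ℝ) - 1) * (((s : ℝ) + 1) ^ (-α)) ^ 2)) := by ring
            _ ≤ _ := by gcongr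
    _ ≤ _ := by
        rw [← Finset.mul_sum]
        gcongr
        exact sum_tsub_mul_rpow_le hκ0 (by omega) N

lemma term_neg (c : (V → Fin 4) → ℝ) (Z : Finset V) : term (-c) Z = -term c Z := by
  simp [term]

lemma hamiltonian_neg (c : (V → Fin 4) → ℝ) : hamiltonian (-c) = -hamiltonian c := by
  simp [hamiltonian, term_neg]

lemma opNorm_neg (A : Op V) : opNorm (-A) = opNorm A := by
  simp [opNorm]

lemma evolve_neg (H : Op V) (t : ℝ) (W : Op V) : evolve (-H) (-t) W = evolve H t W := by
  simp [evolve]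

/-- The leakage bound with the dependence on the sign of the time removed. -/
lemma frobNorm_leakage_le (c : (V → Fin 4) → ℝ) (K : V → V → ℝ)
    (hK : ∀ i j, 0 < K i j) (J lam : ℝ) (hJ : 0 ≤ J) (hlam0 : 0 ≤ lam)
    (hdecay : ∀ i j, ∑ Z ∈ Finset.univ.filter (fun Z : Finset V => i ∈ Z ∧ j ∈ Z),
      opNorm (term c Z) ≤ J * K i j)
    (hconv : ∀ i j, ∑ l, K i l * K l j ≤ lam * K i j)
    {Y R : Finset V} (hYR : Y ⊆ R) {W : Op V} (hW : ActsOn Y W) (hW1 : opNorm W ≤ 1) (t : ℝ) :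
    frobNorm (evolve (hamiltonian c) t W - localApprox R (evolve (hamiltonian c) t W)) ≤
      2 * J * Real.exp (2 * J * lam * |t|) * |t| * √(∑ i ∈ Y, ∑ j ∈ Rᶜ, K i j ^ 2) := by
  rcases le_total 0 t with ht | ht
  · rw [abs_of_nonneg ht]
    exact frobNorm_evolve_sub_localApprox_le c K hK J lam hJ hlam0 hdecay hconv hYR hW hW1 ht
  · rw [abs_of_nonpos ht, ← evolve_neg, ← hamiltonian_neg]
    refine frobNorm_evolve_sub_localApprox_le (-c) K hK J lam hJ hlam0 ?_ hconv hYR hW hW1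
      (by linarith)
    simpa only [term_neg, opNorm_neg] using hdecay

end Main

end LongRange

end

theorem theorem3 {V : Type*} [Fintype V] [DecidableEq V]
    (G : SimpleGraph V) (hG : G.Connected)
    (D : ℕ) (hD : 1 ≤ D) (γ : ℝ) (hγ : 1 ≤ γ) (hlat : LongRange.IsLatticeConstant G D γ)
    (α : ℝ) (hα : (D : ℝ) < α)
    (k : ℕ) (c : (V → Fin 4) → ℝ) (hk : LongRange.IsKLocal c k)
    (J₀ : ℝ) (hJ₀ : 0 < J₀) (hdecay : LongRange.PowerLawDecay G c J₀ α)
    (g : ℝ) (hg : LongRange.OneSiteEnergyBound c g)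
    (lam : ℝ) (hlam : LongRange.ConvolutionBound G α lam)
    (X : Finset V) (r : ℕ) (hr : 1 ≤ r)
    (hreg : LongRange.IsLatticeRegion G D γ ∨
      ∀ l : ℤ, l ≤ ((r / 2 : ℕ) : ℤ) →
        (LongRange.shell G X l).card ≤ (LongRange.shell G X ((r / 2 : ℕ) : ℤ)).card)
    (W : LongRange.Op V) (hWX : LongRange.ActsOn X W) (hW : LongRange.opNorm W = 1)
    (t : ℝ) (ht : |t| ≤ 1 / (2 * Real.exp 1 * LongRange.gTilde g lam J₀ k)) :
    LongRange.frobNorm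
        (LongRange.evolve (LongRange.hamiltonian c) t W
          - LongRange.localApprox (LongRange.nbhd G X r)
              (LongRange.evolve (LongRange.hamiltonian c) t W))
      ≤ LongRange.constC α J₀ γ (LongRange.gTilde g lam J₀ k) D * |t|
          * Real.sqrt (γ⁻¹ * ((LongRange.shell G X ((r / 2 : ℕ) : ℤ)).card : ℝ)
              * (r : ℝ) ^ (-2 * α + D + 1)) := by
  have hD' : (1 : ℝ) ≤ D := by exact_mod_cast hD
  have hr' : (1 : ℝ) ≤ r := by exact_mod_cast hr
  obtain ⟨i₀⟩ := hG.nonempty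
  set K : V → V → ℝ := fun i j => ((G.dist i j : ℝ) + 1) ^ (-α) with hK
  have hKpos : ∀ i j, 0 < K i j := fun i j => by rw [hK]; positivity
  have hlam0 : 0 < lam := by
    have h1 : ∑ j, K i₀ j * K j i₀ ≤ lam * K i₀ i₀ := hlam i₀ i₀
    have h2 : 0 < ∑ j, K i₀ j * K j i₀ :=
      Finset.sum_pos (fun j _ => mul_pos (hKpos _ _) (hKpos _ _)) ⟨i₀, Finset.mem_univ _⟩
    exact pos_of_mul_pos_left (h2.trans_le h1) (hKpos i₀ i₀).le
  set gt := LongRange.gTilde g lam J₀ k with hgt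
  have hJlam : J₀ * lam ≤ gt := by
    have h3 : (1 : ℝ) ≤ (3 : ℝ) ^ ((k : ℝ) / 2) := Real.one_le_rpow (by norm_num) (by positivity)
    refine le_trans ?_ (le_max_right _ _)
    nlinarith [mul_pos hlam0 hJ₀]
  have hgt0 : 0 < gt := (mul_pos hJ₀ hlam0).trans_le hJlam
  -- The time restriction and J₀ λ ≤ g̃ give an exponent of at most 1/e ≤ 1/2 < log 2.
  have hexp : Real.exp (2 * J₀ * lam * |t|) ≤ 2 := by
    have he : 2 ≤ Real.exp 1 := by
      have := Real.add_one_le_exp (1 : ℝ)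
      linarith
    have h1 : 2 * J₀ * lam * |t| ≤ 1 / 2 := by
      rw [le_div_iff₀ (by positivity)] at ht
      have h2 : |t| * (2 * J₀ * lam * 2) ≤ |t| * (2 * Real.exp 1 * gt) := by
        have : 2 * J₀ * lam * 2 ≤ 2 * Real.exp 1 * gt := by nlinarith [mul_pos hJ₀ hlam0]
        gcongr
      linarith
    have h2 := Real.log_two_gt_d9
    calc Real.exp (2 * J₀ * lam * |t|) ≤ Real.exp (Real.log 2) := by
          gcongr
          linarith
      _ = 2 := Real.exp_log two_pos
  set h := r / 2 with hh
  have hhr : h < r := by omega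
  set N : ℝ := ((LongRange.shell G X (h : ℤ)).card : ℝ) with hN
  have hleak := LongRange.frobNorm_leakage_le c K hKpos J₀ lam hJ₀.le hlam0.le hdecay hlam
    (LongRange.nbhd_mono hG X hhr.le) (hWX.mono (LongRange.subset_nbhd hG X h)) hW.le t
  refine hleak.trans ?_
  have hS := LongRange.sum_decay_sq_le hG hD hγ hlat hα hhr hreg
  set S := ∑ i ∈ LongRange.nbhd G X h, ∑ j ∈ (LongRange.nbhd G X r)ᶜ, K i j ^ 2 with hSdef
  set κ := 2 * α - D - 1 with hκ
  have hκ0 : 0 < κ := by rw [hκ]; linarith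
  have hS' : S ≤ N * γ * ((2 : ℝ) ^ κ * (r : ℝ) ^ (-κ) / (κ * (κ + 1))) := by
    refine hS.trans ?_
    -- The gap r - h is ⌈r/2⌉; replacing it by r/2 costs the factor 2^κ.
    have hm : (r : ℝ) / 2 ≤ ((r - h : ℕ) : ℝ) := by
      rw [div_le_iff₀ two_pos]
      have : r ≤ (r - h) * 2 := by omega
      exact_mod_cast this
    have h1 : ((r - h : ℕ) : ℝ) ^ (-κ) ≤ ((r : ℝ) / 2) ^ (-κ) :=
      Real.rpow_le_rpow_of_nonpos (by positivity) hm (by linarith)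
    have h2 : ((r : ℝ) / 2) ^ (-κ) = (2 : ℝ) ^ κ * (r : ℝ) ^ (-κ) := by
      rw [Real.div_rpow (by positivity) (by norm_num), Real.rpow_neg two_pos.le, div_inv_eq_mul,
        mul_comm]
    rw [h2] at h1
    gcongr
  -- The 4 is the prefactor 2 times the bound 2 on the exponential. After squaring, the right side
  -- carries 2^(κ+5)/κ² against 16 · 2^κ/(κ(κ+1)), so a factor 2 is to spare.
  have hmain : 4 * √S ≤ (2 : ℝ) ^ (α - (D : ℝ) / 2 + 2) * γ / κ *
      √(γ⁻¹ * N * (r : ℝ) ^ (-2 * α + D + 1)) := by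
    have hexpo : (-2 * α + D + 1 : ℝ) = -κ := by rw [hκ]; ring
    rw [hexpo]
    refine abs_le_of_sq_le_sq' ?_ (by positivity) |>.2
    rw [mul_pow, mul_pow, Real.sq_sqrt (by positivity), Real.sq_sqrt (by positivity), div_pow,
      mul_pow]
    have h2 : ((2 : ℝ) ^ (α - (D : ℝ) / 2 + 2)) ^ 2 = 32 * (2 : ℝ) ^ κ := by
      rw [← Real.rpow_natCast, ← Real.rpow_mul two_pos.le,
        show (α - (D : ℝ) / 2 + 2) * ((2 : ℕ) : ℝ) = κ + 5 by rw [hκ]; push_cast; ring,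
        Real.rpow_add two_pos, mul_comm]
      norm_num
    rw [h2]
    have h3 : 32 * (2 : ℝ) ^ κ * γ ^ 2 / κ ^ 2 * (γ⁻¹ * N * (r : ℝ) ^ (-κ)) =
        N * γ * (2 * (16 * ((2 : ℝ) ^ κ * (r : ℝ) ^ (-κ) / (κ * κ)))) := by
      field_simp
      ring
    rw [h3]
    have h4 : (2 : ℝ) ^ κ * (r : ℝ) ^ (-κ) / (κ * (κ + 1)) ≤
        (2 : ℝ) ^ κ * (r : ℝ) ^ (-κ) / (κ * κ) := by
      gcongr
      linarith
    have h5 : N * γ * ((2 : ℝ) ^ κ * (r : ℝ) ^ (-κ) / (κ * (κ + 1))) ≤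
        N * γ * ((2 : ℝ) ^ κ * (r : ℝ) ^ (-κ) / (κ * κ)) := by gcongr
    have h6 : 0 ≤ N * γ * ((2 : ℝ) ^ κ * (r : ℝ) ^ (-κ) / (κ * κ)) := by positivity
    linarith
  -- The first summand of C₀ already suffices; of the second only nonnegativity is needed.
  have hsecond : 0 ≤ 80 * gt * γ * (2 : ℝ) ^ (α - (D : ℝ) / 2) / (α - D) *
      √(2 * α - 2 * D + γ) := by
    have : 0 < α - D := by linarith
    positivity
  have hfirst : J₀ * ((2 : ℝ) ^ (α - (D : ℝ) / 2 + 2) * γ / κ) ≤ LongRange.constC α J₀ γ gt D := by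
    rw [LongRange.constC, ← hκ]
    refine le_trans (le_of_eq ?_) (le_add_of_nonneg_right hsecond)
    ring
  calc 2 * J₀ * Real.exp (2 * J₀ * lam * |t|) * |t| * √S
      ≤ 2 * J₀ * 2 * |t| * √S := by gcongr
    _ = J₀ * |t| * (4 * √S) := by ring
    _ ≤ J₀ * |t| * ((2 : ℝ) ^ (α - (D : ℝ) / 2 + 2) * γ / κ *
          √(γ⁻¹ * N * (r : ℝ) ^ (-2 * α + D + 1))) := by gcongr
    _ = J₀ * ((2 : ℝ) ^ (α - (D : ℝ) / 2 + 2) * γ / κ) * |t| *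
          √(γ⁻¹ * N * (r : ℝ) ^ (-2 * α + D + 1)) := by ring
    _ ≤ _ := by gcongr
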